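/- **Setting.** Fix countably many object constants (the *standard names*), countably many action symbols (a *ground action* is an action symbol applied to standard names), and finitely many fluents of arity at most $2$. A *trace* is a finite sequence of ground actions; a *world* $w$ assigns a truth value to every primitive formula $F(\vec n)$ after every trace. $C^2$ fluent formulas are first-order formulas over fluents and equality with counting quantifiers $\exists^{\le m},\exists^{\ge m}$, with at most two variables and no action terms; quantifiers range over the standard names; $w,z\models\phi$ denotes truth after trace $z$. A *basic action theory* $\mathcal D$ consists of a finite set $\mathcal D_0$ of $C^2$ sentences (true initially) and one axiom $\Box[a]F(\vec x)\equiv\gamma_F^+\vee F(\vec x)\wedge\neg\gamma_F^-$ per fluent, where $\gamma_F^\pm$ are finite disjunctions of formulas $\exists\vec y.(a=A(\vec v)\wedge\varepsilon\wedge\kappa)$ with free variables among $\vec x,a$; here $\vec v$ contains $\vec y$, $\varepsilon$ and $\kappa$ are fluent formulas without action terms, at most two variables of $\varepsilon$ fail to occur in $\vec v$ or occur bound, and $\kappa$ has free variables in $\vec v$ and at most two bound variables. It is *acyclic* if the relation "$F'$ occurs in some $\varepsilon$ of $\gamma_F^\pm$" has no cycle. A *Golog program* $\mathcal G=(\mathcal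 D,\delta)$ has $\delta$ built from ground actions and tests $\phi?$ of $C^2$ sentences by $;$, $|$, $\|$ (interleaving) and $*$, with the usual transition relation $\langle z,\rho\rangle\xrightarrow{w}\langle z\cdot\alpha,\rho'\rangle$ and set $\mathrm{Fin}(w)$ of final configurations. Its *characteristic graph* has as nodes the subprograms $\mathrm{sub}(\delta)$ reachable from $\delta$, edges $\rho\xrightarrow{\alpha/\psi}\rho'$ (a step by $\alpha$ is possible if $\psi$ holds), and a termination condition $\varphi(\rho)$ at each node. $\mathcal G$ is *situation-determined* if for $w\models\mathcal D$ and all $z,z'$ at most one $\delta'$ satisfies $\langle z,\delta\rangle\xrightarrow{w}{}^*\langle z',\delta'\rangle$. The set $\mathcal A$ of ground actions occurring in $\delta$ is partitioned as $\mathcal A=\mathcal A_C\,\dot\cup\,\mathcal A_E$ (controllable and environment actions). $\Phi$ is a temporal formula built from $C^2$ sentences by $\neg,\wedge,\mathsf X,\mathsf U$ with finite-trace (LTLf) semantics: $w,z,z'\models\Phi$ evaluates $\Phi$ after $z$ with remaining trace $z'$. **Policies.** A *policy* $\pi$ is a partial map from worlds $\times$ traces $\times\,\mathrm{sub}(\delta)$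 to $2^{\mathcal A}$, defined on $(w,\langle\rangle,\delta)$ whenever $w\models\mathcal D$, such that, wherever $\pi(w,z,\rho)$ is defined: each $\alpha\in\pi(w,z,\rho)$ is executable, i.e. $\langle z,\rho\rangle\xrightarrow{w}\langle z\cdot\alpha,\rho'\rangle$ for some $\rho'\in\mathrm{sub}(\delta)$, and $\pi$ is defined on $(w,z\cdot\alpha,\rho')$ for every such $\rho'$; every executable $\alpha\in\mathcal A_E$ is in $\pi(w,z,\rho)$; and $\pi(w,z,\rho)=\emptyset$ only if $\langle z,\rho\rangle\in\mathrm{Fin}(w)$. It *may stop* at a configuration if that configuration is final and the selected set is contained in $\mathcal A_E$. $\pi$ is *terminating* if every infinite $\pi$-compatible sequence of configurations from $\langle\langle\rangle,\delta\rangle$ contains infinitely many at which it may stop; it *satisfies* $\Phi$ if $w,\langle\rangle,z\models\Phi$ for all $w\models\mathcal D$ and all traces $z$ of $\pi$-compatible runs from $\langle\langle\rangle,\delta\rangle$ in $w$ that end where $\pi$ may stop. **Arena.** An *effect* is a pair $\langle F^\pm,\varepsilon\rangle$, the descriptor $\varepsilon$ being a conjunction read as a set of conjuncts. For a finite set $E$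 of effects, the *regression* $\mathcal R[E,\phi]$ replaces each $F(\vec v)$ in $\phi$ by $F(\vec v)\wedge\bigwedge_{\langle F^-,\varepsilon\rangle\in E}\neg\varepsilon^{\vec x}_{\vec v}\vee\bigvee_{\langle F^+,\varepsilon\rangle\in E}\varepsilon^{\vec x}_{\vec v}$. The *accumulation* is $$E_0\triangleright E_1=\{\langle F^\pm,\mathcal R[E_0,\varepsilon]\rangle:\langle F^\pm,\varepsilon\rangle\in E_1\}\cup\Big\{\Big\langle F^+,\varepsilon\wedge\bigwedge_{\langle F^-,\varepsilon'\rangle\in E_1}\neg\mathcal R[E_0,\varepsilon']\Big\rangle:\langle F^+,\varepsilon\rangle\in E_0\Big\}\cup\{\langle F^-,\varepsilon\rangle\in E_0\}.$$ Instantiating $a$ by $\alpha\in\mathcal A$ turns $\gamma_F^\pm$ into a disjunction of $\varepsilon_i\wedge\kappa_i$, with $\varepsilon_i$ having free variables in $\vec x$ and $\kappa_i$ a sentence. The *relevant effects* $\mathfrak E$ are generated by recursion on the depth $d$ of $F$ (the length of a longest dependency path from $F$), as all $\langle F^-,\mathcal R[E,\varepsilon]\rangle$ and $\langle F^+,\mathcal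 R[E,\varepsilon]\wedge\bigwedge_{(\varepsilon',E')\in X}\neg\mathcal R[E',\varepsilon']\rangle$, where $\varepsilon$ is an instantiated descriptor of $F$ of the respective sign, $\varepsilon'$ ranges over negative ones, and $E,E'$ are sets of relevant effects on fluents of depth $<d$. The *context* is the least set closed under negation that contains $\mathcal D_0$, the instantiated $\kappa_i$, the guards and termination conditions of the characteristic graph, and the sentences in $\Phi$. A *type* is a set $\tau$ of pairs $(\psi,E)$, $\psi$ in the context and $E\subseteq\mathfrak E$, that contains $(\psi,E)$ or $(\neg\psi,E)$ for all such $\psi,E$ and for which some world satisfies $\mathcal D_0$ and all $\mathcal R[E,\psi]$, $(\psi,E)\in\tau$, initially; $\mathrm{type}(w)=\{(\psi,E): w\models\mathcal R[E,\psi]\}$. Let $\mathcal E(\tau,E,\alpha)$ be the set of $\langle F^\pm,\varepsilon\rangle$ with $(\varepsilon,\kappa)$ in $\gamma_F^\pm$ instantiated by $\alpha$ and $(\kappa,E)\in\tau$. Let $\widehat\Phi$ be the tail normal form of $\Phi$: take the negation normal form (with weak next $\mathsf X_w$ and release $\mathsf R$), recursively rewrite $\mathsf X\Psi\mapsto\neg\mathrm{Tail}\wedge\mathsf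 X\Psi$, $\mathsf X_w\Psi\mapsto\mathrm{Tail}\vee\mathsf X\Psi$, $\Psi_1\mathsf U\Psi_2\mapsto(\neg\mathrm{Tail}\wedge\Psi_1)\mathsf U\Psi_2$, $\Psi_1\mathsf R\Psi_2\mapsto(\mathrm{Tail}\vee\Psi_1)\mathsf R\Psi_2$, and add the conjunct $\top\,\mathsf U\,\mathrm{Tail}$. Let $\mathrm{xnf}$ unfold outermost operators by $\Psi_1\mathsf U\Psi_2\mapsto\mathrm{xnf}(\Psi_2)\vee(\mathrm{xnf}(\Psi_1)\wedge\mathsf X(\Psi_1\mathsf U\Psi_2))$ and $\Psi_1\mathsf R\Psi_2\mapsto\mathrm{xnf}(\Psi_2)\wedge(\mathrm{xnf}(\Psi_1)\vee\mathsf X(\Psi_1\mathsf R\Psi_2))$. For a formula $\Psi$, let $\mathrm{tr}(\tau,E,\Psi)$ be the set of pairs $(X(P),T(P))$ for partial assignments $P$ that satisfy $\mathrm{xnf}(\Psi)$ propositionally (fluent sentences, $\mathrm{Tail}$ and $\mathsf X$-formulas being atoms) and whose fluent literals $\psi$ all satisfy $(\psi,E)\in\tau$; here $X(P)=\{\theta: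 P(\mathsf X\theta)=1\}$, and $T(P)=\top$ if $P(\mathrm{Tail})=1$, else $\bot$. The *game arena* has as states the tuples $(\tau,E,A,\rho)$ with $\tau$ a type, $E\subseteq\mathfrak E$, $\rho\in\mathrm{sub}(\delta)$ and $A$ a set of pairs $(\chi,\theta)$ with $\chi$ a set of subformulas of $\widehat\Phi$ and $\theta\in\{\top,\bot\}$. Initial states are $(\mathrm{type}(w),\emptyset,\mathrm{tr}(\mathrm{type}(w),\emptyset,\widehat\Phi),\delta)$ for $w\models\mathcal D$. There is a transition $(\tau,E_1,A_1,\rho_1)\xrightarrow{\alpha}(\tau,E_2,A_2,\rho_2)$ iff there is an edge $\rho_1\xrightarrow{\alpha/\psi}\rho_2$ with $(\psi,E_1)\in\tau$, $E_2=E_1\triangleright\mathcal E(\tau,E_1,\alpha)$ and $A_2=\bigcup_{(\chi,\bot)\in A_1}\mathrm{tr}(\tau,E_2,\bigwedge\chi)$. A state is *final* if $(\varphi(\rho),E)\in\tau$ and *accepting* if $(\emptyset,\top)\in A$. **Strategies.** A *strategy* $\sigma$ is a partial map from states to $2^{\mathcal A}$, defined on all initial states, such that wherever $\sigma(s)$ is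 defined: every $\alpha\in\sigma(s)$ labels a transition from $s$, and $\sigma$ is defined on all $\alpha$-successors of $s$; every $\alpha\in\mathcal A_E$ labelling a transition from $s$ is in $\sigma(s)$; and $\sigma(s)=\emptyset$ only if $s$ is final. It *may stop* at $s$ if $s$ is final and $\sigma(s)\subseteq\mathcal A_E$. $\sigma$ is *winning* if every finite $\sigma$-compatible path from an initial state to a state where it may stop ends in an accepting state; it is *terminating* if every infinite $\sigma$-compatible path (from any state) contains infinitely many states where it may stop. **Proposition.** Let $\mathcal G=(\mathcal D,\delta)$ be a situation-determined Golog program with acyclic $\mathcal D$, let $\mathcal A=\mathcal A_C\,\dot\cup\,\mathcal A_E$ be a partition of its ground actions, and let $\Phi$ be a temporal formula. Then the game arena for $\mathcal G$ and $\Phi$ has finitely many states, and there is a terminating and winning strategy in the game arena if and only if there exists a terminating policy for $\mathcal G$ that satisfies $\Phi$. -/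

import Mathlib

namespace Golog

/-! ### First-order fluent formulas over standard names -/

/-- The vocabulary: countably many object constants (which are the standard names of sort object),
the finitely many fluents of the theory (with at most two arguments), and countably many action
function symbols. -/
structure Signature where
  Obj : Type
  Flu : Type
  Act : Type
  fluArity : Flu → ℕ
  fluArity_le : ∀ F, fluArity F ≤ 2
  actArity : Act → ℕ
  countableObj : Countable Obj
  infiniteObj : Infinite Obj
  fintypeFlu : Fintype Flu
  countableAct : Countable Act
  infiniteAct : Infinite Act

attribute [instance] Signature.countableObj Signature.infiniteObj Signature.fintypeFlu
  Signature.countableAct Signature.infiniteAct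

/-- Ground actions, i.e. standard names of sort action. -/
def GAct (S : Signature) : Type := (A : S.Act) × (Fin (S.actArity A) → S.Obj)

/-- Traces (situations): finite sequences of ground actions. -/
abbrev Trace (S : Signature) : Type := List (GAct S)

/-- A world fixes the truth of each primitive formula `F(n₁,…,nₖ)` after each trace. -/
def World (S : Signature) : Type :=
  (F : S.Flu) → (Fin (S.fluArity F) → S.Obj) → Trace S → Prop

/-- Object terms with free variables among `0, …, n-1`. -/
inductive Term (S : Signature) (n : ℕ) : Type
  | var (i : Fin n)
  | const (c : S.Obj)

/-- Fluent formulas without actions, with free variables among `0, …, n-1` (de Bruijn indices: a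
quantifier binds variable `0` of its body). -/
inductive Fml (S : Signature) : ℕ → Type
  | top {n : ℕ} : Fml S n
  | fluent {n : ℕ} (F : S.Flu) (ts : Fin (S.fluArity F) → Term S n) : Fml S n
  | eq {n : ℕ} (s t : Term S n) : Fml S n
  | neg {n : ℕ} (φ : Fml S n) : Fml S n
  | and {n : ℕ} (φ ψ : Fml S n) : Fml S n
  | all {n : ℕ} (φ : Fml S (n + 1)) : Fml S n
  | atMost {n : ℕ} (m : ℕ) (φ : Fml S (n + 1)) : Fml S n
  | atLeast {n : ℕ} (m : ℕ) (φ : Fml S (n + 1)) : Fml S n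

variable {S : Signature}

namespace Term

def eval {n : ℕ} (b : Fin n → S.Obj) : Term S n → S.Obj
  | var i => b i
  | const c => c

def lift {n : ℕ} : Term S n → Term S (n + 1)
  | var i => var i.succ
  | const c => const c

def subst {m n : ℕ} (σ : Fin m → Term S n) : Term S m → Term S n
  | var i => σ i
  | const c => const c

/-- The variables of a term. -/
def fv {n : ℕ} : Term S n → Set (Fin n)
  | var i => {i}
  | const _ => ∅

end Term

namespace Fml

def bot {n : ℕ} : Fml S n := neg top

def or {n : ℕ} (φ ψ : Fml S n) : Fml S n := neg (and (neg φ) (neg ψ))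

def conj {n : ℕ} (l : List (Fml S n)) : Fml S n := l.foldr and top

def disj {n : ℕ} (l : List (Fml S n)) : Fml S n := l.foldr or bot

/-- Truth of `φ` in world `w` after trace `z` under the assignment `b` of standard names. -/
def Sat (w : World S) (z : Trace S) : {n : ℕ} → Fml S n → (Fin n → S.Obj) → Prop
  | _, top, _ => True
  | _, fluent F ts, b => w F (fun i => (ts i).eval b) z
  | _, eq s t, b => s.eval b = t.eval b
  | _, neg φ, b => ¬ Sat w z φ b
  | _, and φ ψ, b => Sat w z φ b ∧ Sat w z ψ b
  | _, all φ, b => ∀ o : S.Obj, Sat w z φ (Fin.cons o b)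
  | _, atMost m φ, b => {o : S.Obj | Sat w z φ (Fin.cons o b)}.encard ≤ m
  | _, atLeast m φ, b => (m : ℕ∞) ≤ {o : S.Obj | Sat w z φ (Fin.cons o b)}.encard

/-- Truth of a sentence: `w, z ⊨ φ`. -/
def TrueAt (w : World S) (z : Trace S) (φ : Fml S 0) : Prop := φ.Sat w z Fin.elim0

/-- Extension of a substitution below a quantifier. -/
def up {m n : ℕ} (σ : Fin m → Term S n) : Fin (m + 1) → Term S (n + 1) :=
  Fin.cons (Term.var 0) (fun i => (σ i).lift)

/-- Capture-avoiding simultaneous substitution. -/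
def subst : {m n : ℕ} → (Fin m → Term S n) → Fml S m → Fml S n
  | _, _, _, top => top
  | _, _, σ, fluent F ts => fluent F (fun i => (ts i).subst σ)
  | _, _, σ, eq s t => eq (s.subst σ) (t.subst σ)
  | _, _, σ, neg φ => neg (subst σ φ)
  | _, _, σ, and φ ψ => and (subst σ φ) (subst σ ψ)
  | _, _, σ, all φ => all (subst (up σ) φ)
  | _, _, σ, atMost k φ => atMost k (subst (up σ) φ)
  | _, _, σ, atLeast k φ => atLeast k (subst (up σ) φ)

/-- The free variables of a formula. -/
def fv : {n : ℕ} → Fml S n → Set (Fin n)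
  | _, top => ∅
  | _, fluent _ ts => {i | ∃ j, i ∈ (ts j).fv}
  | _, eq s t => s.fv ∪ t.fv
  | _, neg φ => fv φ
  | _, and φ ψ => fv φ ∪ fv ψ
  | _, all φ => {i | i.succ ∈ fv φ}
  | _, atMost _ φ => {i | i.succ ∈ fv φ}
  | _, atLeast _ φ => {i | i.succ ∈ fv φ}

/-- The fluents that occur in a formula. -/
def fluents : {n : ℕ} → Fml S n → Set S.Flu
  | _, top => ∅
  | _, fluent F _ => {F}
  | _, eq _ _ => ∅
  | _, neg φ => fluents φ
  | _, and φ ψ => fluents φ ∪ fluents ψ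
  | _, all φ => fluents φ
  | _, atMost _ φ => fluents φ
  | _, atLeast _ φ => fluents φ

/-- Every subformula has at most two free variables outside the exempt set `X` (variables bound
inside the formula are never exempt). Up to renaming of bound variables this says that the formula
is written with at most two variables apart from the free occurrences of those in `X`. -/
def TwoVar : {n : ℕ} → Set (Fin n) → Fml S n → Prop
  | _, _, top => True
  | _, X, fluent F ts => (fv (fluent F ts) \ X).encard ≤ 2
  | _, X, eq s t => (fv (eq s t) \ X).encard ≤ 2
  | _, X, neg φ => TwoVar X φ
  | _, X, and φ ψ => (fv (and φ ψ) \ X).encard ≤ 2 ∧ TwoVar X φ ∧ TwoVar X ψ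
  | _, X, all φ => TwoVar (Fin.succ '' X) φ
  | _, X, atMost _ φ => TwoVar (Fin.succ '' X) φ
  | _, X, atLeast _ φ => TwoVar (Fin.succ '' X) φ

/-- Membership in the two-variable fragment with counting `C²`. -/
def IsC2 {n : ℕ} (φ : Fml S n) : Prop := φ.TwoVar ∅

end Fml

/-! ### Basic action theories -/

/-- A disjunct `∃ y₁…y_k. (a = A(v) ∧ ε ∧ κ)` of an effect condition for a fluent `F(x₁,…,x_n)`.
The variables `0,…,n-1` are the `x`s and `n,…,n+k-1` are the `y`s. -/
structure EffDisj (S : Signature) (n : ℕ) where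
  k : ℕ
  A : S.Act
  v : Fin (S.actArity A) → Term S (n + k)
  eps : Fml S (n + k)
  kap : Fml S (n + k)
  y_mem : ∀ y : Fin k, ∃ j, v j = Term.var (Fin.natAdd n y)
  kap_fv : ∀ i ∈ kap.fv, ∃ j, v j = Term.var i
  eps_twoVar : eps.TwoVar {i | ∃ j, v j = Term.var i}
  kap_twoVar : kap.TwoVar Set.univ

namespace EffDisj

variable {n : ℕ}

/-- The ground action `A(v)` under an assignment. -/
def actAt (d : EffDisj S n) (b : Fin (n + d.k) → S.Obj) : GAct S :=
  ⟨d.A, fun j => (d.v j).eval b⟩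

/-- Truth of the disjunct for `a := α` and `x := xs` in world `w` after `z`. -/
def Holds (d : EffDisj S n) (w : World S) (z : Trace S) (α : GAct S) (xs : Fin n → S.Obj) : Prop :=
  ∃ ys : Fin d.k → S.Obj, α = d.actAt (Fin.append xs ys) ∧
    d.eps.Sat w z (Fin.append xs ys) ∧ d.kap.Sat w z (Fin.append xs ys)

open Classical in
/-- The instance of `ε` obtained from an assignment `b` with `A(v) = α`: the `y`s are replaced by
their values, and every `x` that is an argument of `A(v)` is constrained to equal its value. -/
noncomputable def epsAt (d : EffDisj S n) (b : Fin (n + d.k) → S.Obj) : Fml S n :=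
  Fml.and
    (d.eps.subst (Fin.append (fun i => Term.var i) (fun y => Term.const (b (Fin.natAdd n y)))))
    (Fml.conj (((List.finRange n).filter
        (fun i => decide (∃ j, d.v j = Term.var (Fin.castAdd d.k i)))).map
      (fun i => Fml.eq (Term.var i) (Term.const (b (Fin.castAdd d.k i))))))

/-- The instance of `κ`, a sentence. -/
def kapAt (d : EffDisj S n) (b : Fin (n + d.k) → S.Obj) : Fml S 0 :=
  d.kap.subst (fun i => Term.const (b i))

open Classical in
/-- The pair `(ε, κ)` that the disjunct contributes after substituting the ground action `α` for `a`
(none, if `α` is not an instance of `A(v)`). All assignments with `A(v) = α` agree on the variables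
of `v`, hence give the same pair. -/
noncomputable def ground (d : EffDisj S n) (α : GAct S) : Option (Fml S n × Fml S 0) :=
  if h : ∃ b, d.actAt b = α then some (d.epsAt h.choose, d.kapAt h.choose) else none

end EffDisj

/-- A basic action theory: the initial axioms, and for each fluent `F` the disjuncts of `γ_F⁺` and
`γ_F⁻` in its successor state axiom `□[a]F(x) ≡ γ_F⁺ ∨ F(x) ∧ ¬γ_F⁻`. -/
structure BAT (S : Signature) where
  initial : Finset (Fml S 0)
  initial_c2 : ∀ φ ∈ initial, φ.IsC2
  pos : (F : S.Flu) → List (EffDisj S (S.fluArity F))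
  neg : (F : S.Flu) → List (EffDisj S (S.fluArity F))

namespace BAT

/-- `w ⊨ D₀`. -/
def SatInitial (D : BAT S) (w : World S) : Prop := ∀ φ ∈ D.initial, φ.TrueAt w []

/-- `w ⊨ D`: the initial axioms hold initially, and every successor state axiom holds. -/
def Sat (D : BAT S) (w : World S) : Prop :=
  D.SatInitial w ∧
  ∀ (F : S.Flu) (z : Trace S) (α : GAct S) (xs : Fin (S.fluArity F) → S.Obj),
    w F xs (z ++ [α]) ↔
      ((∃ d ∈ D.pos F, d.Holds w z α xs) ∨ (w F xs z ∧ ¬ ∃ d ∈ D.neg F, d.Holds w z α xs))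

/-- The disjuncts of `γ_F⁺` (`true`) or `γ_F⁻` (`false`). -/
def cond (D : BAT S) : Bool → (F : S.Flu) → List (EffDisj S (S.fluArity F))
  | true, F => D.pos F
  | false, F => D.neg F

/-- The pairs `(ε, κ)` of `γ_F⁺` or `γ_F⁻` instantiated with the ground action `α`. -/
noncomputable def grounded (D : BAT S) (sgn : Bool) (F : S.Flu) (α : GAct S) :
    List (Fml S (S.fluArity F) × Fml S 0) :=
  (D.cond sgn F).filterMap (fun d => d.ground α)

/-- The edges of the fluent dependency graph. -/
def DepEdge (D : BAT S) (F F' : S.Flu) : Prop :=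
  ∃ sgn, ∃ d ∈ D.cond sgn F, F' ∈ d.eps.fluents

def Acyclic (D : BAT S) : Prop := ∀ F, ¬ Relation.TransGen D.DepEdge F F

/-- There is a path of length `n` starting in `F`. -/
def HasPath (D : BAT S) : ℕ → S.Flu → Prop
  | 0, _ => True
  | n + 1, F => ∃ F', D.DepEdge F F' ∧ D.HasPath n F'

/-- The fluent depth of `F`. -/
noncomputable def fluentDepth (D : BAT S) (F : S.Flu) : ℕ := sSup {n | D.HasPath n F}

/-- The fluent depth of an acyclic theory. -/
noncomputable def depth (D : BAT S) : ℕ := sSup {n | ∃ F, D.HasPath n F}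

end BAT

/-! ### Program expressions -/

inductive Prog (S : Signature) : Type
  | act (α : GAct S)
  | test (φ : Fml S 0)
  | seq (δ₁ δ₂ : Prog S)
  | choice (δ₁ δ₂ : Prog S)
  | par (δ₁ δ₂ : Prog S)
  | star (δ : Prog S)

namespace Prog

/-- The empty program. -/
def nil : Prog S := test Fml.top

/-- The ground actions occurring in a program expression. -/
def actions : Prog S → Set (GAct S)
  | act α => {α}
  | test _ => ∅
  | seq δ₁ δ₂ => actions δ₁ ∪ actions δ₂
  | choice δ₁ δ₂ => actions δ₁ ∪ actions δ₂
  | par δ₁ δ₂ => actions δ₁ ∪ actions δ₂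
  | star δ => actions δ

/-- All tests are `C²` sentences. -/
def IsC2 : Prog S → Prop
  | act _ => True
  | test φ => φ.IsC2
  | seq δ₁ δ₂ => IsC2 δ₁ ∧ IsC2 δ₂
  | choice δ₁ δ₂ => IsC2 δ₁ ∧ IsC2 δ₂
  | par δ₁ δ₂ => IsC2 δ₁ ∧ IsC2 δ₂
  | star δ => IsC2 δ

/-- The termination condition of a program expression. -/
def termCond : Prog S → Fml S 0
  | act _ => Fml.bot
  | test φ => φ
  | seq δ₁ δ₂ => Fml.and (termCond δ₁) (termCond δ₂)
  | choice δ₁ δ₂ => Fml.or (termCond δ₁) (termCond δ₂)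
  | par δ₁ δ₂ => Fml.and (termCond δ₁) (termCond δ₂)
  | star _ => Fml.top

/-- The edges of characteristic graphs: `Edge δ α ψ ρ` is an edge from `δ` to `ρ` with action `α` and
guard `ψ`. -/
inductive Edge : Prog S → GAct S → Fml S 0 → Prog S → Prop
  | act (α : GAct S) : Edge (act α) α Fml.top nil
  | seq_left {δ₁ δ₂ ρ : Prog S} {α : GAct S} {ψ : Fml S 0} :
      Edge δ₁ α ψ ρ → Edge (seq δ₁ δ₂) α ψ (seq ρ δ₂)
  | seq_right {δ₁ δ₂ ρ : Prog S} {α : GAct S} {ψ : Fml S 0} :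
      Edge δ₂ α ψ ρ → Edge (seq δ₁ δ₂) α (Fml.and (termCond δ₁) ψ) ρ
  | choice_left {δ₁ δ₂ ρ : Prog S} {α : GAct S} {ψ : Fml S 0} :
      Edge δ₁ α ψ ρ → Edge (choice δ₁ δ₂) α ψ ρ
  | choice_right {δ₁ δ₂ ρ : Prog S} {α : GAct S} {ψ : Fml S 0} :
      Edge δ₂ α ψ ρ → Edge (choice δ₁ δ₂) α ψ ρ
  | par_left {δ₁ δ₂ ρ : Prog S} {α : GAct S} {ψ : Fml S 0} :
      Edge δ₁ α ψ ρ → Edge (par δ₁ δ₂) α ψ (par ρ δ₂)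
  | par_right {δ₁ δ₂ ρ : Prog S} {α : GAct S} {ψ : Fml S 0} :
      Edge δ₂ α ψ ρ → Edge (par δ₁ δ₂) α ψ (par δ₁ ρ)
  | star {δ ρ : Prog S} {α : GAct S} {ψ : Fml S 0} :
      Edge δ α ψ ρ → Edge (star δ) α ψ (seq ρ (star δ))

/-- The nodes of the characteristic graph of `δ`: the subprograms reachable from `δ`. -/
def sub (δ : Prog S) : Set (Prog S) :=
  {ρ | Relation.ReflTransGen (fun δ₁ δ₂ => ∃ α ψ, Edge δ₁ α ψ δ₂) δ ρ}

/-- The final configurations of a world. -/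
inductive Final (w : World S) : Trace S → Prog S → Prop
  | test {z : Trace S} {φ : Fml S 0} : φ.TrueAt w z → Final w z (test φ)
  | seq {z : Trace S} {δ₁ δ₂ : Prog S} : Final w z δ₁ → Final w z δ₂ → Final w z (seq δ₁ δ₂)
  | choice_left {z : Trace S} {δ₁ δ₂ : Prog S} : Final w z δ₁ → Final w z (choice δ₁ δ₂)
  | choice_right {z : Trace S} {δ₁ δ₂ : Prog S} : Final w z δ₂ → Final w z (choice δ₁ δ₂)
  | par {z : Trace S} {δ₁ δ₂ : Prog S} : Final w z δ₁ → Final w z δ₂ → Final w z (par δ₁ δ₂)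
  | star {z : Trace S} {δ : Prog S} : Final w z (star δ)

/-- The transition relation among configurations: `Trans w (z, δ) (z', ρ)`. -/
inductive Trans (w : World S) : Trace S × Prog S → Trace S × Prog S → Prop
  | act (z : Trace S) (α : GAct S) : Trans w (z, act α) (z ++ [α], nil)
  | seq_left {z z' : Trace S} {δ₁ δ₂ ρ : Prog S} :
      Trans w (z, δ₁) (z', ρ) → Trans w (z, seq δ₁ δ₂) (z', seq ρ δ₂)
  | seq_right {z z' : Trace S} {δ₁ δ₂ ρ : Prog S} :
      Final w z δ₁ → Trans w (z, δ₂) (z', ρ) → Trans w (z, seq δ₁ δ₂) (z', ρ)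
  | choice_left {z z' : Trace S} {δ₁ δ₂ ρ : Prog S} :
      Trans w (z, δ₁) (z', ρ) → Trans w (z, choice δ₁ δ₂) (z', ρ)
  | choice_right {z z' : Trace S} {δ₁ δ₂ ρ : Prog S} :
      Trans w (z, δ₂) (z', ρ) → Trans w (z, choice δ₁ δ₂) (z', ρ)
  | par_left {z z' : Trace S} {δ₁ δ₂ ρ : Prog S} :
      Trans w (z, δ₁) (z', ρ) → Trans w (z, par δ₁ δ₂) (z', par ρ δ₂)
  | par_right {z z' : Trace S} {δ₁ δ₂ ρ : Prog S} :
      Trans w (z, δ₂) (z', ρ) → Trans w (z, par δ₁ δ₂) (z', par δ₁ ρ)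
  | star {z z' : Trace S} {δ ρ : Prog S} :
      Trans w (z, δ) (z', ρ) → Trans w (z, star δ) (z', seq ρ (star δ))

end Prog

/-- A Golog program `G = (D, δ)`. -/
structure GologProgram (S : Signature) where
  bat : BAT S
  prog : Prog S
  prog_c2 : prog.IsC2

namespace GologProgram

/-- The ground actions of the program. -/
def actions (G : GologProgram S) : Set (GAct S) := G.prog.actions

def SituationDetermined (G : GologProgram S) : Prop :=
  ∀ w : World S, G.bat.Sat w → ∀ (z z' : Trace S) (δ' δ'' : Prog S),
    Relation.ReflTransGen (Prog.Trans w) (z, G.prog) (z', δ') →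
    Relation.ReflTransGen (Prog.Trans w) (z, G.prog) (z', δ'') → δ' = δ''

end GologProgram

/-! ### Temporal formulas on finite traces -/

/-- Temporal formulas whose atoms are fluent sentences. -/
inductive LTLf (S : Signature) : Type
  | atom (φ : Fml S 0)
  | not (Φ : LTLf S)
  | and (Φ₁ Φ₂ : LTLf S)
  | next (Φ : LTLf S)
  | until (Φ₁ Φ₂ : LTLf S)

namespace LTLf

/-- The fluent sentences occurring in a temporal formula. -/
def atoms : LTLf S → Set (Fml S 0)
  | atom φ => {φ}
  | not Φ => atoms Φ
  | and Φ₁ Φ₂ => atoms Φ₁ ∪ atoms Φ₂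
  | next Φ => atoms Φ
  | .until Φ₁ Φ₂ => atoms Φ₁ ∪ atoms Φ₂

/-- All atoms are `C²` sentences. -/
def IsC2 (Φ : LTLf S) : Prop := ∀ φ ∈ Φ.atoms, φ.IsC2

/-- `w, z, z' ⊨ Φ`: truth after the past `z` with the remaining trace `z'`. -/
def Sat (w : World S) : LTLf S → Trace S → Trace S → Prop
  | atom φ, z, _ => φ.TrueAt w z
  | not Φ, z, z' => ¬ Sat w Φ z z'
  | and Φ₁ Φ₂, z, z' => Sat w Φ₁ z z' ∧ Sat w Φ₂ z z'
  | next Φ, z, z' => ∃ α z'', z' = α :: z'' ∧ Sat w Φ (z ++ [α]) z''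
  | .until Φ₁ Φ₂, z, z' => ∃ k ≤ z'.length, Sat w Φ₂ (z ++ z'.take k) (z'.drop k) ∧
      ∀ i < k, Sat w Φ₁ (z ++ z'.take i) (z'.drop i)

end LTLf

/-- Temporal formulas in negation normal form; `lit b φ` is `φ` or `¬φ`, `wnext` is weak next. -/
inductive NForm (S : Signature) : Type
  | lit (b : Bool) (φ : Fml S 0)
  | and (Φ₁ Φ₂ : NForm S)
  | or (Φ₁ Φ₂ : NForm S)
  | next (Φ : NForm S)
  | wnext (Φ : NForm S)
  | until (Φ₁ Φ₂ : NForm S)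
  | release (Φ₁ Φ₂ : NForm S)

/-- `Φ.nnf true` is the negation normal form of `Φ`, `Φ.nnf false` that of `¬Φ`. -/
def LTLf.nnf : LTLf S → Bool → NForm S
  | .atom φ, b => .lit b φ
  | .not Φ, b => Φ.nnf (!b)
  | .and Φ₁ Φ₂, true => .and (Φ₁.nnf true) (Φ₂.nnf true)
  | .and Φ₁ Φ₂, false => .or (Φ₁.nnf false) (Φ₂.nnf false)
  | .next Φ, true => .next (Φ.nnf true)
  | .next Φ, false => .wnext (Φ.nnf false)
  | .until Φ₁ Φ₂, true => .until (Φ₁.nnf true) (Φ₂.nnf true)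
  | .until Φ₁ Φ₂, false => .release (Φ₁.nnf false) (Φ₂.nnf false)

/-- Formulas that may mention the atom `Tail` (`tail true` is `Tail` and `tail false` is `¬Tail`). -/
inductive TForm (S : Signature) : Type
  | tt
  | ff
  | lit (b : Bool) (φ : Fml S 0)
  | tail (b : Bool)
  | and (Φ₁ Φ₂ : TForm S)
  | or (Φ₁ Φ₂ : TForm S)
  | next (Φ : TForm S)
  | until (Φ₁ Φ₂ : TForm S)
  | release (Φ₁ Φ₂ : TForm S)

/-- The recursive part of the tail normal form. -/
def NForm.tnft : NForm S → TForm S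
  | .lit b φ => .lit b φ
  | .and Φ₁ Φ₂ => .and Φ₁.tnft Φ₂.tnft
  | .or Φ₁ Φ₂ => .or Φ₁.tnft Φ₂.tnft
  | .next Φ => .and (.tail false) (.next Φ.tnft)
  | .wnext Φ => .or (.tail true) (.next Φ.tnft)
  | .until Φ₁ Φ₂ => .until (.and (.tail false) Φ₁.tnft) Φ₂.tnft
  | .release Φ₁ Φ₂ => .release (.or (.tail true) Φ₁.tnft) Φ₂.tnft

/-- The tail normal form: the recursive part together with "eventually `Tail`". -/
def LTLf.tnf (Φ : LTLf S) : TForm S :=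
  .and (Φ.nnf true).tnft (.until .tt (.tail true))

namespace TForm

/-- The conjunction of a finite set of formulas. -/
noncomputable def bigAnd (χ : Finset (TForm S)) : TForm S := χ.toList.foldr and tt

/-- The subformulas. -/
def closure : TForm S → Set (TForm S)
  | tt => {tt}
  | ff => {ff}
  | lit b φ => {lit b φ}
  | tail b => {tail b}
  | and Φ₁ Φ₂ => {and Φ₁ Φ₂} ∪ closure Φ₁ ∪ closure Φ₂
  | or Φ₁ Φ₂ => {or Φ₁ Φ₂} ∪ closure Φ₁ ∪ closure Φ₂
  | next Φ => {next Φ} ∪ closure Φ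
  | .until Φ₁ Φ₂ => {.until Φ₁ Φ₂} ∪ closure Φ₁ ∪ closure Φ₂
  | release Φ₁ Φ₂ => {release Φ₁ Φ₂} ∪ closure Φ₁ ∪ closure Φ₂

/-- The next normal form. -/
def xnf : TForm S → TForm S
  | tt => tt
  | ff => ff
  | lit b φ => lit b φ
  | tail b => tail b
  | and Φ₁ Φ₂ => and (xnf Φ₁) (xnf Φ₂)
  | or Φ₁ Φ₂ => or (xnf Φ₁) (xnf Φ₂)
  | next Φ => next Φ
  | .until Φ₁ Φ₂ => or (xnf Φ₂) (and (xnf Φ₁) (next (.until Φ₁ Φ₂)))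
  | release Φ₁ Φ₂ => and (xnf Φ₂) (or (xnf Φ₁) (next (release Φ₁ Φ₂)))

/-- The propositional atoms: fluent sentences, `Tail`, and outermost temporal subformulas. -/
def propAtoms : TForm S → Set (TForm S)
  | tt => ∅
  | ff => ∅
  | lit _ φ => {lit true φ}
  | tail _ => {tail true}
  | and Φ₁ Φ₂ => propAtoms Φ₁ ∪ propAtoms Φ₂
  | or Φ₁ Φ₂ => propAtoms Φ₁ ∪ propAtoms Φ₂
  | next Φ => {next Φ}
  | .until Φ₁ Φ₂ => {.until Φ₁ Φ₂}
  | release Φ₁ Φ₂ => {release Φ₁ Φ₂}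

/-- A partial truth assignment `P` satisfies the formula, read propositionally. -/
def PropSat (P : TForm S → Option Bool) : TForm S → Prop
  | tt => True
  | ff => False
  | lit b φ => P (lit true φ) = some b
  | tail b => P (tail true) = some b
  | and Φ₁ Φ₂ => PropSat P Φ₁ ∧ PropSat P Φ₂
  | or Φ₁ Φ₂ => PropSat P Φ₁ ∨ PropSat P Φ₂
  | next Φ => P (next Φ) = some true
  | .until Φ₁ Φ₂ => P (.until Φ₁ Φ₂) = some true
  | release Φ₁ Φ₂ => P (release Φ₁ Φ₂) = some true

/-- `P` is a satisfying propositional assignment of the formula: a partial function on its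
propositional atoms that satisfies it. -/
def IsSatAssignment (P : TForm S → Option Bool) (Φ : TForm S) : Prop :=
  (∀ p, P p ≠ none → p ∈ Φ.propAtoms) ∧ PropSat P Φ

/-- `L(P)`: the fluent literals of `P`. -/
def literals (P : TForm S → Option Bool) : Set (Fml S 0) :=
  {φ | P (lit true φ) = some true} ∪ {ψ | ∃ φ, P (lit true φ) = some false ∧ ψ = Fml.neg φ}

/-- `X(P)`: the obligations for the next state. -/
def nexts (P : TForm S → Option Bool) : Set (TForm S) := {θ | P (next θ) = some true}

/-- `T(P)`: whether `P` contains `Tail`. -/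
def hasTail (P : TForm S → Option Bool) : Bool := P (tail true) == some true

end TForm

/-! ### Effects and types -/

/-- An effect `⟨F⁺, ε⟩` (`sgn = true`) or `⟨F⁻, ε⟩` (`sgn = false`). The descriptor `ε` is a
conjunction, given as the finite set of its conjuncts. -/
structure Effect (S : Signature) where
  flu : S.Flu
  sgn : Bool
  desc : Finset (Fml S (S.fluArity flu))

/-- The formula denoted by a descriptor. -/
noncomputable def descFml {n : ℕ} (D : Finset (Fml S n)) : Fml S n := Fml.conj D.toList

/-- The descriptors `ε` with `⟨F^sgn, ε⟩ ∈ E`. -/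
noncomputable def descs (E : Finset (Effect S)) (F : S.Flu) (sgn : Bool) :
    Finset (Finset (Fml S (S.fluArity F))) :=
  E.preimage (fun D => (⟨F, sgn, D⟩ : Effect S)) (by
    intro D₁ _ D₂ _ h
    simpa using h)

/-- Regression of a fluent formula through a set of effects. -/
noncomputable def regress (E : Finset (Effect S)) : {n : ℕ} → Fml S n → Fml S n
  | _, .top => .top
  | _, .fluent F ts =>
      Fml.or
        (Fml.and (.fluent F ts)
          (Fml.conj ((descs E F false).toList.map (fun D => Fml.neg ((descFml D).subst ts)))))
        (Fml.disj ((descs E F true).toList.map (fun D => (descFml D).subst ts)))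
  | _, .eq s t => .eq s t
  | _, .neg φ => .neg (regress E φ)
  | _, .and φ ψ => .and (regress E φ) (regress E ψ)
  | _, .all φ => .all (regress E φ)
  | _, .atMost m φ => .atMost m (regress E φ)
  | _, .atLeast m φ => .atLeast m (regress E φ)

open Classical in
/-- Regression of a descriptor. -/
noncomputable def regressDesc {n : ℕ} (E : Finset (Effect S)) (D : Finset (Fml S n)) :
    Finset (Fml S n) :=
  D.image (fun φ => regress E φ)

open Classical in
/-- The accumulation `E₀ ▷ E₁`. -/
noncomputable def accumulate (E₀ E₁ : Finset (Effect S)) : Finset (Effect S) :=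
  E₁.image (fun e => ⟨e.flu, e.sgn, regressDesc E₀ e.desc⟩)
  ∪ (E₀.filter (fun e => e.sgn = true)).image (fun e => ⟨e.flu, true,
      e.desc ∪ (descs E₁ e.flu false).image (fun D => Fml.neg (descFml (regressDesc E₀ D)))⟩)
  ∪ E₀.filter (fun e => e.sgn = false)

/-- Sets of type elements `(ψ, E)`. -/
abbrev TypeSet (S : Signature) : Type := Set (Fml S 0 × Finset (Effect S))

open Classical in
/-- The effects of executing `α` in `(τ, E)`. -/
noncomputable def effectsOf (D : BAT S) (τ : TypeSet S) (E : Finset (Effect S)) (α : GAct S) :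
    Finset (Effect S) :=
  (Finset.univ : Finset (S.Flu × Bool)).biUnion (fun q =>
    ((D.grounded q.2 q.1 α).toFinset.filter (fun p => (p.2, E) ∈ τ)).image
      (fun p => (⟨q.1, q.2, {p.1}⟩ : Effect S)))

namespace GologProgram

/-- The effect descriptors of `F` (positive for `true`, negative for `false`) with respect to the
actions of the program. -/
def effDescs (G : GologProgram S) (sgn : Bool) (F : S.Flu) : Set (Fml S (S.fluArity F)) :=
  {ε | ∃ α ∈ G.actions, ∃ κ, (ε, κ) ∈ G.bat.grounded sgn F α}

open Classical in
/-- The relevant effects on fluents of depth smaller than `j`. -/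
noncomputable def effectsBelow (G : GologProgram S) : ℕ → Set (Effect S)
  | 0 => ∅
  | j + 1 => effectsBelow G j
      ∪ {e | ∃ F ε, ∃ E : Finset (Effect S), G.bat.fluentDepth F = j ∧ ε ∈ G.effDescs false F ∧
          (E : Set (Effect S)) ⊆ effectsBelow G j ∧ e = ⟨F, false, regressDesc E {ε}⟩}
      ∪ {e | ∃ F φ, ∃ E : Finset (Effect S),
          ∃ X : Finset (Fml S (S.fluArity F) × Finset (Effect S)),
          G.bat.fluentDepth F = j ∧ φ ∈ G.effDescs true F ∧
          (E : Set (Effect S)) ⊆ effectsBelow G j ∧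
          (∀ p ∈ X, p.1 ∈ G.effDescs false F ∧ (p.2 : Set (Effect S)) ⊆ effectsBelow G j) ∧
          e = ⟨F, true, regressDesc E {φ} ∪
            X.image (fun p => Fml.neg (descFml (regressDesc p.2 {p.1})))⟩}

/-- The set of all relevant effects. -/
noncomputable def relevantEffects (G : GologProgram S) : Set (Effect S) :=
  G.effectsBelow (G.bat.depth + 1)

/-- The context of the program and the temporal formula. -/
inductive Context (G : GologProgram S) (Φ : LTLf S) : Fml S 0 → Prop
  | initial {φ : Fml S 0} : φ ∈ G.bat.initial → Context G Φ φ
  | contextCond {sgn : Bool} {F : S.Flu} {α : GAct S} {ε : Fml S (S.fluArity F)} {κ : Fml S 0} :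
      α ∈ G.actions → (ε, κ) ∈ G.bat.grounded sgn F α → Context G Φ κ
  | guard {ρ ρ' : Prog S} {α : GAct S} {ψ : Fml S 0} :
      ρ ∈ G.prog.sub → Prog.Edge ρ α ψ ρ' → Context G Φ ψ
  | termCond {ρ : Prog S} : ρ ∈ G.prog.sub → Context G Φ ρ.termCond
  | temporal {φ : Fml S 0} : φ ∈ Φ.atoms → Context G Φ φ
  | neg {φ : Fml S 0} : Context G Φ φ → Context G Φ φ.neg

/-- The set of all type elements. -/
def typeElements (G : GologProgram S) (Φ : LTLf S) : TypeSet S :=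
  {p | G.Context Φ p.1 ∧ (p.2 : Set (Effect S)) ⊆ G.relevantEffects}

/-- `τ` is a type. -/
def IsType (G : GologProgram S) (Φ : LTLf S) (τ : TypeSet S) : Prop :=
  τ ⊆ G.typeElements Φ ∧
  (∀ ψ, G.Context Φ ψ → ∀ E : Finset (Effect S), (E : Set (Effect S)) ⊆ G.relevantEffects →
    ((ψ, E) ∈ τ ∨ (ψ.neg, E) ∈ τ)) ∧
  ∃ w : World S, G.bat.SatInitial w ∧ ∀ p ∈ τ, (regress p.2 p.1).TrueAt w []

/-- The type of a world. -/
def typeOf (G : GologProgram S) (Φ : LTLf S) (w : World S) : TypeSet S :=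
  {p | p ∈ G.typeElements Φ ∧ (regress p.2 p.1).TrueAt w []}

end GologProgram

/-! ### The game arena -/

/-- A tuple `(τ, E, A, ρ)`. -/
structure ArenaState (S : Signature) where
  type : TypeSet S
  effects : Finset (Effect S)
  track : Set (Finset (TForm S) × Bool)
  prog : Prog S

/-- The pairs `(X(P), T(P))` for the satisfying propositional assignments `P` of the next normal form
of `Ψ` whose fluent literals hold according to `(τ, E)`. -/
def trackSet (τ : TypeSet S) (E : Finset (Effect S)) (Ψ : TForm S) :
    Set (Finset (TForm S) × Bool) :=
  {q | ∃ P : TForm S → Option Bool, TForm.IsSatAssignment P Ψ.xnf ∧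
    (∀ ψ ∈ TForm.literals P, (ψ, E) ∈ τ) ∧
    (q.1 : Set (TForm S)) = TForm.nexts P ∧ q.2 = TForm.hasTail P}

namespace GologProgram

/-- The states of the game arena. -/
def arenaStates (G : GologProgram S) (Φ : LTLf S) : Set (ArenaState S) :=
  {s | G.IsType Φ s.type ∧ s.prog ∈ G.prog.sub ∧
    (s.effects : Set (Effect S)) ⊆ G.relevantEffects ∧
    ∀ q ∈ s.track, (q.1 : Set (TForm S)) ⊆ Φ.tnf.closure}

/-- The initial states of the game arena. -/
def arenaInitial (G : GologProgram S) (Φ : LTLf S) : Set (ArenaState S) :=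
  {s | s ∈ G.arenaStates Φ ∧ (∃ w : World S, G.bat.Sat w ∧ s.type = G.typeOf Φ w) ∧
    s.prog = G.prog ∧ s.effects = ∅ ∧ s.track = trackSet s.type s.effects Φ.tnf}

/-- The transitions `s₁ →α s₂` of the game arena. -/
def ArenaTrans (G : GologProgram S) (Φ : LTLf S) (s₁ : ArenaState S) (α : GAct S)
    (s₂ : ArenaState S) : Prop :=
  s₁ ∈ G.arenaStates Φ ∧ s₂ ∈ G.arenaStates Φ ∧
  s₂.type = s₁.type ∧
  (∃ ψ, Prog.Edge s₁.prog α ψ s₂.prog ∧ (ψ, s₁.effects) ∈ s₁.type) ∧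
  s₂.effects = accumulate s₁.effects (effectsOf G.bat s₁.type s₁.effects α) ∧
  s₂.track = {q | ∃ q₁ ∈ s₁.track, q₁.2 = false ∧
    q ∈ trackSet s₁.type s₂.effects (TForm.bigAnd q₁.1)}

end GologProgram

namespace ArenaState

def IsFinal (s : ArenaState S) : Prop := (s.prog.termCond, s.effects) ∈ s.type

def IsAccepting (s : ArenaState S) : Prop := ((∅ : Finset (TForm S)), true) ∈ s.track

end ArenaState

namespace GologProgram

/-- `U` is a valid set of actions in the arena state `s`, where `AE` are the environment actions. -/
def ValidIn (G : GologProgram S) (Φ : LTLf S) (AE : Set (GAct S)) (s : ArenaState S)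
    (U : Set (GAct S)) : Prop :=
  U ⊆ G.actions ∧
  (∀ α ∈ U, ∃ s', G.ArenaTrans Φ s α s') ∧
  (∀ α ∈ AE, ∀ s', G.ArenaTrans Φ s α s' → α ∈ U) ∧
  (U = ∅ → s.IsFinal)

end GologProgram

/-- A strategy in the game arena: a partial function from arena states to sets of actions. -/
structure Strategy (G : GologProgram S) (Φ : LTLf S) (AE : Set (GAct S)) where
  toFun : ArenaState S → Option (Set (GAct S))
  dom : ∀ s U, toFun s = some U → s ∈ G.arenaStates Φ
  initial : ∀ s ∈ G.arenaInitial Φ, ∃ U, toFun s = some U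
  valid : ∀ s U, toFun s = some U → G.ValidIn Φ AE s U
  succ : ∀ s U, toFun s = some U → ∀ α ∈ U, ∀ s', G.ArenaTrans Φ s α s' →
    ∃ U', toFun s' = some U'

namespace Strategy

variable {G : GologProgram S} {Φ : LTLf S} {AE : Set (GAct S)}

/-- `s →σ s'`. -/
def Step (σ : Strategy G Φ AE) (s s' : ArenaState S) : Prop :=
  ∃ U, σ.toFun s = some U ∧ ∃ α ∈ U, G.ArenaTrans Φ s α s'

/-- In `s` the strategy selects environment actions only and `s` is final. -/
def StopsAt (σ : Strategy G Φ AE) (s : ArenaState S) : Prop :=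
  ∃ U, σ.toFun s = some U ∧ U ⊆ AE ∧ s.IsFinal

/-- The sequence `s₀, …, s_n` is a play of the strategy. -/
def IsPlay (σ : Strategy G Φ AE) (n : ℕ) (s : Fin (n + 1) → ArenaState S) : Prop :=
  s 0 ∈ G.arenaInitial Φ ∧ (∀ i : Fin n, σ.Step (s i.castSucc) (s i.succ)) ∧
  σ.StopsAt (s (Fin.last n))

/-- Every play ends in an accepting state. -/
def Winning (σ : Strategy G Φ AE) : Prop :=
  ∀ (n : ℕ) (s : Fin (n + 1) → ArenaState S), σ.IsPlay n s → (s (Fin.last n)).IsAccepting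

def Terminating (σ : Strategy G Φ AE) : Prop :=
  ∀ s : ℕ → ArenaState S, (∀ k, σ.Step (s k) (s (k + 1))) → ∀ i, ∃ j ≥ i, σ.StopsAt (s j)

end Strategy

/-! ### Policies -/

/-- A policy: a partial function on worlds, traces and subprograms with values sets of actions. -/
structure Policy (G : GologProgram S) (AE : Set (GAct S)) where
  toFun : World S → Trace S → Prog S → Option (Set (GAct S))
  dom : ∀ w z ρ U, toFun w z ρ = some U → ρ ∈ G.prog.sub ∧ U ⊆ G.actions
  initial : ∀ w, G.bat.Sat w → ∃ U, toFun w [] G.prog = some U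
  applicable : ∀ w z ρ U, toFun w z ρ = some U → ∀ α ∈ U,
    ∃ ρ' ∈ G.prog.sub, Prog.Trans w (z, ρ) (z ++ [α], ρ')
  succ : ∀ w z ρ U, toFun w z ρ = some U → ∀ α ∈ U,
    ∀ ρ', Prog.Trans w (z, ρ) (z ++ [α], ρ') → ∃ U', toFun w (z ++ [α]) ρ' = some U'
  environment : ∀ w z ρ U, toFun w z ρ = some U → ∀ α ∈ AE,
    (∃ ρ' ∈ G.prog.sub, Prog.Trans w (z, ρ) (z ++ [α], ρ')) → α ∈ U
  nonblocking : ∀ w z ρ, toFun w z ρ = some ∅ → Prog.Final w z ρ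

namespace Policy

variable {G : GologProgram S} {AE : Set (GAct S)}

/-- The configuration `c'` results from `c` by an action selected by the policy in world `w`. -/
def Step (π : Policy G AE) (w : World S) (c c' : Trace S × Prog S) : Prop :=
  ∃ U, π.toFun w c.1 c.2 = some U ∧ ∃ α ∈ U, c'.1 = c.1 ++ [α] ∧ Prog.Trans w c c'

/-- In configuration `c` the policy selects environment actions only and `c` is final. -/
def StopsAt (π : Policy G AE) (w : World S) (c : Trace S × Prog S) : Prop :=
  ∃ U, π.toFun w c.1 c.2 = some U ∧ U ⊆ AE ∧ Prog.Final w c.1 c.2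

/-- The traces `z = ⟨α₁,…,α_n⟩` induced by the policy in world `w`. -/
def traces (π : Policy G AE) (w : World S) : Set (Trace S) :=
  {z | ∃ ρ : ℕ → Prog S, ρ 0 = G.prog ∧
    (∀ i < z.length, π.Step w (z.take i, ρ i) (z.take (i + 1), ρ (i + 1))) ∧
    π.StopsAt w (z, ρ z.length)}

def Terminating (π : Policy G AE) : Prop :=
  ∀ (w : World S) (c : ℕ → Trace S × Prog S), c 0 = ([], G.prog) →
    (∀ k, π.Step w (c k) (c (k + 1))) → ∀ i, ∃ j ≥ i, π.StopsAt w (c j)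

/-- Every induced trace in every world of the theory satisfies the temporal formula. -/
def Satisfies (π : Policy G AE) (Φ : LTLf S) : Prop :=
  ∀ w, G.bat.Sat w → ∀ z ∈ π.traces w, Φ.Sat w [] z

end Policy

end Golog

/-!
The arena has finitely many states because all its ingredients are finite: subprograms, subformulas
of the tail normal form, and relevant effects, which are built by recursion on the fluent depth from
finitely many instantiated descriptors. The context is infinite, being closed under negation, but a
type is the type of any world that realizes it (`IsType.exists_eq_typeOf`) and is therefore
determined by its elements over the finitely many generators of the context (`types_finite`).

For a world `w` of the theory and a trace `z` of program actions, accumulate the effects of the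
actions according to the type of `w`. Regression through a set of effects expresses truth in the
world updated by these effects (`sat_regress`), and accumulation composes updates
(`update_accumulate`), so the accumulated effects yield exactly the fluent values of `w` after `z`
(`world_iff_update_effectsAlong`), and the type decides the context formulas as `w` does after `z`
(`mem_typeOf_iff`). Acyclicity ensures that the accumulated effects are relevant: regressing a
descriptor of `F` only involves effects on fluents of smaller depth
(`accumulate_effectsOf_subset`). The component that tracks the temporal formula contains `(∅, ⊤)`
iff `z`, as a complete trace, satisfies the formula (`accepting_trackAlong_iff`): an accepted
sequence of assignments makes the formula true, by going backwards from the end, and on a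
satisfying trace the actual truth values form such a sequence.

Hence each configuration `⟨z, ρ⟩` in `w` has an arena state, the transitions from the configuration
and from its state correspond to each other (`arenaTrans_stateOf_iff`), and so do finality and
acceptance. A strategy becomes a policy by playing it in these states. A policy, however, may depend
on the world and on the whole trace, while a strategy depends on the arena state only. Let `X` be the
states of the configurations that a given terminating and satisfying policy reaches. Every state in
`X` lies in the attractor of the states where stopping is possible with all successors in `X`: were
one outside, the policy could be followed forever outside the attractor without stopping
(`Policy.exists_mem_attractor`). Choosing in each state the actions that witness the least attractor
level is a memoryless strategy. The level decreases until the strategy may stop, so it is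
terminating, and as only choices were admitted that permit to stop in accepting states alone, it is
winning (`exists_strategy_of_subset_attractor`).
-/

namespace Golog

variable {S : Signature}

/-! ### Semantics of fluent formulas -/

lemma Term.eval_subst {m n : ℕ} (σ : Fin m → Term S n) (t : Term S m) (b : Fin n → S.Obj) :
    (t.subst σ).eval b = t.eval (fun i => (σ i).eval b) := by
  cases t <;> rfl

lemma Term.eval_lift {n : ℕ} (t : Term S n) (o : S.Obj) (b : Fin n → S.Obj) :
    t.lift.eval (Fin.cons o b : Fin (n + 1) → S.Obj) = t.eval b := by
  cases t <;> simp [Term.lift, Term.eval]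

lemma Term.eval_congr {n : ℕ} (t : Term S n) {b b' : Fin n → S.Obj}
    (h : ∀ i ∈ t.fv, b i = b' i) : t.eval b = t.eval b' := by
  cases t with
  | var i => exact h i rfl
  | const c => rfl

namespace Fml

variable {w w' : World S} {z z' : Trace S} {n : ℕ}

lemma sat_or (φ ψ : Fml S n) (b : Fin n → S.Obj) :
    (or φ ψ).Sat w z b ↔ φ.Sat w z b ∨ ψ.Sat w z b := by
  simp only [or, Sat]; tauto

lemma sat_conj (l : List (Fml S n)) (b : Fin n → S.Obj) :
    (conj l).Sat w z b ↔ ∀ φ ∈ l, φ.Sat w z b := by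
  induction l with
  | nil => simp [conj, Sat]
  | cons φ l ih =>
    have : conj (φ :: l) = and φ (conj l) := rfl
    simp [this, Sat, ih]

lemma sat_disj (l : List (Fml S n)) (b : Fin n → S.Obj) :
    (disj l).Sat w z b ↔ ∃ φ ∈ l, φ.Sat w z b := by
  induction l with
  | nil => simp [disj, Sat, bot]
  | cons φ l ih =>
    have : disj (φ :: l) = or φ (disj l) := rfl
    simp [this, sat_or, ih]

lemma sat_descFml (D : Finset (Fml S n)) (b : Fin n → S.Obj) :
    (descFml D).Sat w z b ↔ ∀ φ ∈ D, φ.Sat w z b := by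
  simp [descFml, sat_conj]

lemma eval_up {m n : ℕ} (σ : Fin m → Term S n) (o : S.Obj) (b : Fin n → S.Obj) :
    (fun i => (up σ i).eval (Fin.cons o b : Fin (n + 1) → S.Obj)) =
      Fin.cons o (fun i => (σ i).eval b) := by
  funext i
  refine Fin.cases ?_ (fun i => ?_) i
  · simp [up, Term.eval]
  · simp [up, Term.eval_lift]

lemma sat_subst {m : ℕ} (φ : Fml S m) : ∀ {n : ℕ} (σ : Fin m → Term S n) (b : Fin n → S.Obj),
    (φ.subst σ).Sat w z b ↔ φ.Sat w z (fun i => (σ i).eval b) := by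
  induction φ with
  | top => simp [subst, Sat]
  | fluent F ts => simp [subst, Sat, Term.eval_subst]
  | eq s t => simp [subst, Sat, Term.eval_subst]
  | neg φ ih => simp [subst, Sat, ih]
  | and φ ψ ih₁ ih₂ => simp [subst, Sat, ih₁, ih₂]
  | all φ ih => simp [subst, Sat, ih, eval_up]
  | atMost k φ ih => simp [subst, Sat, ih, eval_up]
  | atLeast k φ ih => simp [subst, Sat, ih, eval_up]

lemma sat_congr_fv {n : ℕ} (φ : Fml S n) : ∀ {b b' : Fin n → S.Obj}, (∀ i ∈ φ.fv, b i = b' i) →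
    (φ.Sat w z b ↔ φ.Sat w z b') := by
  have key : ∀ {n : ℕ} {X : Set (Fin (n + 1))} {b b' : Fin n → S.Obj} (o : S.Obj),
      (∀ i, i.succ ∈ X → b i = b' i) → ∀ i ∈ X,
        (Fin.cons o b : Fin (n + 1) → S.Obj) i = (Fin.cons o b' : Fin (n + 1) → S.Obj) i := by
    intro n X b b' o h i
    refine Fin.cases ?_ (fun i hi => ?_) i
    · simp
    · simpa using h i hi
  induction φ with
  | top => simp [Sat]
  | fluent F ts =>
    intro b b' h
    have : (fun i => (ts i).eval b) = fun i => (ts i).eval b' :=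
      funext fun j => Term.eval_congr _ fun i hi => h i ⟨j, hi⟩
    simp only [Sat, this]
  | eq s t =>
    intro b b' h
    simp only [Sat, Term.eval_congr s fun i hi => h i (Or.inl hi),
      Term.eval_congr t fun i hi => h i (Or.inr hi)]
  | neg φ ih => intro b b' h; simp only [Sat, ih h]
  | and φ ψ ih₁ ih₂ =>
    intro b b' h
    simp only [Sat, ih₁ fun i hi => h i (Or.inl hi), ih₂ fun i hi => h i (Or.inr hi)]
  | all φ ih => intro b b' h; simp only [Sat, fun o => ih (key o h)]
  | atMost k φ ih => intro b b' h; simp only [Sat, fun o => ih (key o h)]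
  | atLeast k φ ih => intro b b' h; simp only [Sat, fun o => ih (key o h)]

/-- Truth of a fluent formula depends only on the current values of the fluents. -/
lemma sat_congr_world (h : ∀ F xs, w F xs z ↔ w' F xs z') {n : ℕ} (φ : Fml S n) :
    ∀ b : Fin n → S.Obj, φ.Sat w z b ↔ φ.Sat w' z' b := by
  induction φ with
  | top => simp [Sat]
  | fluent F ts => intro b; exact h F _
  | eq s t => simp [Sat]
  | neg φ ih => simp [Sat, ih]
  | and φ ψ ih₁ ih₂ => simp [Sat, ih₁, ih₂]
  | all φ ih => simp [Sat, ih]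
  | atMost k φ ih => simp [Sat, ih]
  | atLeast k φ ih => simp [Sat, ih]

lemma fluents_subst {m : ℕ} (φ : Fml S m) : ∀ {n : ℕ} (σ : Fin m → Term S n),
    (φ.subst σ).fluents = φ.fluents := by
  induction φ with
  | top => simp [subst, fluents]
  | fluent F ts => simp [subst, fluents]
  | eq s t => simp [subst, fluents]
  | neg φ ih => simp [subst, fluents, ih]
  | and φ ψ ih₁ ih₂ => simp [subst, fluents, ih₁, ih₂]
  | all φ ih => simp [subst, fluents, ih]
  | atMost k φ ih => simp [subst, fluents, ih]
  | atLeast k φ ih => simp [subst, fluents, ih]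

lemma fluents_conj (l : List (Fml S n)) {F : S.Flu} (h : F ∈ (conj l).fluents) :
    ∃ φ ∈ l, F ∈ φ.fluents := by
  induction l with
  | nil => simp [conj, fluents] at h
  | cons φ l ih =>
    rcases h with h | h
    · exact ⟨φ, by simp, h⟩
    · obtain ⟨ψ, hψ, hF⟩ := ih h
      exact ⟨ψ, by simp [hψ], hF⟩

end Fml

/-! ### Regression and accumulation -/

lemma mem_descs {E : Finset (Effect S)} {F : S.Flu} {sgn : Bool}
    {D : Finset (Fml S (S.fluArity F))} : D ∈ descs E F sgn ↔ (⟨F, sgn, D⟩ : Effect S) ∈ E :=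
  Finset.mem_preimage

/-- Some effect in `E` on `F` of the given sign has a descriptor that holds initially for the
arguments `xs`. -/
def World.Affected (w : World S) (E : Finset (Effect S)) (F : S.Flu) (sgn : Bool)
    (xs : Fin (S.fluArity F) → S.Obj) : Prop :=
  ∃ D : Finset (Fml S (S.fluArity F)), (⟨F, sgn, D⟩ : Effect S) ∈ E ∧ ∀ φ ∈ D, φ.Sat w [] xs

/-- The world whose fluents have, after every trace, the values that result from applying `E` to
the initial values of `w`. -/
def World.update (w : World S) (E : Finset (Effect S)) : World S := fun F xs _ =>
  (w F xs [] ∧ ¬ w.Affected E F false xs) ∨ w.Affected E F true xs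

lemma sat_regress (w : World S) (E : Finset (Effect S)) {n : ℕ} (φ : Fml S n) :
    ∀ b : Fin n → S.Obj, (regress E φ).Sat w [] b ↔ φ.Sat (w.update E) [] b := by
  induction φ with
  | top => simp [regress, Fml.Sat]
  | fluent F ts =>
    intro b
    simp [regress, Fml.Sat, Fml.sat_or, Fml.sat_conj, Fml.sat_disj, World.update, World.Affected,
      Fml.sat_subst, Fml.sat_descFml, mem_descs]
  | eq s t => simp [regress, Fml.Sat]
  | neg φ ih => simp [regress, Fml.Sat, ih]
  | and φ ψ ih₁ ih₂ => simp [regress, Fml.Sat, ih₁, ih₂]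
  | all φ ih => simp [regress, Fml.Sat, ih]
  | atMost k φ ih => simp [regress, Fml.Sat, ih]
  | atLeast k φ ih => simp [regress, Fml.Sat, ih]

lemma trueAt_regress (w : World S) (E : Finset (Effect S)) (φ : Fml S 0) :
    (regress E φ).TrueAt w [] ↔ φ.TrueAt (w.update E) [] :=
  sat_regress w E φ _

lemma sat_regressDesc (w : World S) (E : Finset (Effect S)) {n : ℕ} (D : Finset (Fml S n))
    (b : Fin n → S.Obj) :
    (∀ φ ∈ regressDesc E D, φ.Sat w [] b) ↔ ∀ φ ∈ D, φ.Sat (w.update E) [] b := by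
  simp [regressDesc, sat_regress]

lemma mem_accumulate_false {E₀ E₁ : Finset (Effect S)} {F : S.Flu}
    {D : Finset (Fml S (S.fluArity F))} :
    (⟨F, false, D⟩ : Effect S) ∈ accumulate E₀ E₁ ↔
      (∃ D', (⟨F, false, D'⟩ : Effect S) ∈ E₁ ∧ D = regressDesc E₀ D') ∨
        (⟨F, false, D⟩ : Effect S) ∈ E₀ := by
  classical
  simp only [accumulate, Finset.mem_union, Finset.mem_image, Finset.mem_filter]
  constructor
  · rintro ((⟨⟨F', s, D'⟩, h, he⟩ | ⟨⟨F', s, D'⟩, h, he⟩) | h)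
    · cases he
      exact Or.inl ⟨D', h, rfl⟩
    · cases he
    · exact Or.inr h.1
  · rintro (⟨D', h, rfl⟩ | h)
    · exact Or.inl (Or.inl ⟨_, h, rfl⟩)
    · exact Or.inr ⟨h, trivial⟩

open Classical in
lemma mem_accumulate_true {E₀ E₁ : Finset (Effect S)} {F : S.Flu}
    {D : Finset (Fml S (S.fluArity F))} :
    (⟨F, true, D⟩ : Effect S) ∈ accumulate E₀ E₁ ↔
      (∃ D', (⟨F, true, D'⟩ : Effect S) ∈ E₁ ∧ D = regressDesc E₀ D') ∨
        ∃ D', (⟨F, true, D'⟩ : Effect S) ∈ E₀ ∧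
          D = D' ∪ (descs E₁ F false).image (fun D => Fml.neg (descFml (regressDesc E₀ D))) := by
  simp only [accumulate, Finset.mem_union, Finset.mem_image, Finset.mem_filter]
  constructor
  · rintro ((⟨⟨F', s, D'⟩, h, he⟩ | ⟨⟨F', s, D'⟩, h, he⟩) | h)
    · cases he
      exact Or.inl ⟨D', h, rfl⟩
    · obtain ⟨h, hs⟩ := h
      cases he
      cases hs
      exact Or.inr ⟨D', h, rfl⟩
    · exact absurd h.2 (by simp)
  · rintro (⟨D', h, rfl⟩ | ⟨D', h, rfl⟩)
    · exact Or.inl (Or.inl ⟨_, h, rfl⟩)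
    · exact Or.inl (Or.inr ⟨_, ⟨h, rfl⟩, rfl⟩)

lemma affected_accumulate_false (w : World S) (E₀ E₁ : Finset (Effect S)) (F : S.Flu)
    (xs : Fin (S.fluArity F) → S.Obj) :
    w.Affected (accumulate E₀ E₁) F false xs ↔
      (w.update E₀).Affected E₁ F false xs ∨ w.Affected E₀ F false xs := by
  simp only [World.Affected, mem_accumulate_false]
  constructor
  · rintro ⟨D, ⟨D', h, rfl⟩ | h, hD⟩
    · exact Or.inl ⟨D', h, (sat_regressDesc ..).1 hD⟩
    · exact Or.inr ⟨D, h, hD⟩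
  · rintro (⟨D, h, hD⟩ | ⟨D, h, hD⟩)
    · exact ⟨_, Or.inl ⟨D, h, rfl⟩, (sat_regressDesc ..).2 hD⟩
    · exact ⟨D, Or.inr h, hD⟩

lemma affected_accumulate_true (w : World S) (E₀ E₁ : Finset (Effect S)) (F : S.Flu)
    (xs : Fin (S.fluArity F) → S.Obj) :
    w.Affected (accumulate E₀ E₁) F true xs ↔
      (w.update E₀).Affected E₁ F true xs ∨
        (w.Affected E₀ F true xs ∧ ¬ (w.update E₀).Affected E₁ F false xs) := by
  classical
  have key : ∀ D' : Finset (Fml S (S.fluArity F)),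
      (∀ φ ∈ D' ∪ (descs E₁ F false).image (fun D => Fml.neg (descFml (regressDesc E₀ D))),
        φ.Sat w [] xs) ↔
      (∀ φ ∈ D', φ.Sat w [] xs) ∧ ¬ (w.update E₀).Affected E₁ F false xs := by
    intro D'
    simp only [Finset.mem_union, or_imp, forall_and, Finset.mem_image, forall_exists_index,
      and_imp, forall_apply_eq_imp_iff₂, Fml.Sat, Fml.sat_descFml, sat_regressDesc, mem_descs,
      World.Affected, not_exists, not_and]
  simp only [World.Affected, mem_accumulate_true] at key ⊢
  constructor
  · rintro ⟨D, ⟨D', h, rfl⟩ | ⟨D', h, rfl⟩, hD⟩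
    · exact Or.inl ⟨D', h, (sat_regressDesc ..).1 hD⟩
    · exact Or.inr ⟨⟨D', h, ((key D').1 hD).1⟩, ((key D').1 hD).2⟩
  · rintro (⟨D, h, hD⟩ | ⟨⟨D, h, hD⟩, hn⟩)
    · exact ⟨_, Or.inl ⟨D, h, rfl⟩, (sat_regressDesc ..).2 hD⟩
    · exact ⟨_, Or.inr ⟨D, h, rfl⟩, (key D).2 ⟨hD, hn⟩⟩

/-- Accumulating effects amounts to applying them one after the other. -/
lemma update_accumulate (w : World S) (E₀ E₁ : Finset (Effect S)) (F : S.Flu)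
    (xs : Fin (S.fluArity F) → S.Obj) (z : Trace S) :
    w.update (accumulate E₀ E₁) F xs z ↔ (w.update E₀).update E₁ F xs z := by
  have h₁ := affected_accumulate_false w E₀ E₁ F xs
  have h₂ := affected_accumulate_true w E₀ E₁ F xs
  change (_ ∧ ¬ _) ∨ _ ↔ (((_ ∧ ¬ _) ∨ _) ∧ ¬ _) ∨ _
  rw [h₁, h₂]
  tauto

lemma update_empty (w : World S) (F : S.Flu) (xs : Fin (S.fluArity F) → S.Obj) (z : Trace S) :
    w.update ∅ F xs z ↔ w F xs [] := by
  simp [World.update, World.Affected]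

/-! ### Grounding of effect conditions -/

namespace EffDisj

variable {n : ℕ}

lemma actAt_eq_iff (d : EffDisj S n) (b b' : Fin (n + d.k) → S.Obj) :
    d.actAt b = d.actAt b' ↔ ∀ j, (d.v j).eval b = (d.v j).eval b' := by
  constructor
  · intro h j
    have := eq_of_heq (Sigma.mk.inj h).2
    exact congrFun this j
  · intro h
    simp only [actAt, h]
    rfl

lemma actAt_eq_iff_var (d : EffDisj S n) (b b' : Fin (n + d.k) → S.Obj) :
    d.actAt b = d.actAt b' ↔ ∀ i, (∃ j, d.v j = Term.var i) → b i = b' i := by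
  rw [actAt_eq_iff]
  constructor
  · rintro h i ⟨j, hj⟩
    simpa [hj, Term.eval] using h j
  · intro h j
    cases hv : d.v j with
    | var i => exact h i ⟨j, hv⟩
    | const c => rfl

lemma sat_epsAt (d : EffDisj S n) (b : Fin (n + d.k) → S.Obj) (w : World S) (z : Trace S)
    (xs : Fin n → S.Obj) :
    (d.epsAt b).Sat w z xs ↔ d.eps.Sat w z (Fin.append xs (fun y => b (Fin.natAdd n y))) ∧
      d.actAt (Fin.append xs (fun y => b (Fin.natAdd n y))) = d.actAt b := by
  have h₁ : (fun i => ((Fin.append (fun i => Term.var i)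
      (fun y => Term.const (b (Fin.natAdd n y))) : Fin (n + d.k) → Term S n) i).eval xs) =
      Fin.append xs (fun y => b (Fin.natAdd n y)) := by
    funext i
    refine Fin.addCases (fun i => ?_) (fun i => ?_) i <;> simp [Term.eval]
  simp only [epsAt, Fml.Sat, Fml.sat_subst, h₁, Fml.sat_conj, actAt_eq_iff_var]
  refine and_congr_right fun _ => ?_
  constructor
  · intro h i hi
    induction i using Fin.addCases with
    | left i =>
      have := h (Fml.eq (Term.var i) (Term.const (b (Fin.castAdd d.k i)))) (by
        simp only [List.mem_map, List.mem_filter, List.mem_finRange, true_and]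
        exact ⟨i, by simpa using hi, rfl⟩)
      simpa [Fml.Sat, Term.eval] using this
    | right i => simp
  · intro h φ hφ
    simp only [List.mem_map, List.mem_filter, List.mem_finRange, true_and, decide_eq_true_eq]
      at hφ
    obtain ⟨i, hi, rfl⟩ := hφ
    simpa [Fml.Sat, Term.eval] using h _ hi

lemma trueAt_kapAt (d : EffDisj S n) (b : Fin (n + d.k) → S.Obj) (w : World S) (z : Trace S) :
    (d.kapAt b).TrueAt w z ↔ d.kap.Sat w z b := by
  simp [kapAt, Fml.TrueAt, Fml.sat_subst, Term.eval]

lemma kap_congr (d : EffDisj S n) {b b' : Fin (n + d.k) → S.Obj} (h : d.actAt b = d.actAt b')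
    (w : World S) (z : Trace S) : d.kap.Sat w z b ↔ d.kap.Sat w z b' :=
  Fml.sat_congr_fv _ fun i hi => (d.actAt_eq_iff_var b b').1 h i (d.kap_fv i hi)

/-- A disjunct holds for the ground action `α` iff both parts of its instance do. -/
lemma holds_iff_ground (d : EffDisj S n) (w : World S) (z : Trace S) (α : GAct S)
    (xs : Fin n → S.Obj) :
    d.Holds w z α xs ↔ ∃ p, d.ground α = some p ∧ p.1.Sat w z xs ∧ p.2.TrueAt w z := by
  unfold ground
  split_ifs with h
  · have hb := h.choose_spec
    simp only [Option.some.injEq, exists_eq_left', sat_epsAt, trueAt_kapAt]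
    constructor
    · rintro ⟨ys, hα, hε, hκ⟩
      have heq := hα.symm.trans hb.symm
      have hy : (fun y => h.choose (Fin.natAdd n y)) = ys := by
        funext y
        simpa using ((d.actAt_eq_iff_var _ _).1 heq (Fin.natAdd n y) (d.y_mem y)).symm
      rw [hy]
      exact ⟨⟨hε, heq⟩, (d.kap_congr heq w z).1 hκ⟩
    · rintro ⟨⟨hε, heq⟩, hκ⟩
      exact ⟨_, (heq.trans hb).symm, hε, (d.kap_congr heq w z).2 hκ⟩
  · simp only [false_and, exists_false, iff_false]
    rintro ⟨ys, hα, -⟩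
    exact h ⟨_, hα.symm⟩

end EffDisj

lemma BAT.exists_holds_iff (D : BAT S) (sgn : Bool) (F : S.Flu) (w : World S) (z : Trace S)
    (α : GAct S) (xs : Fin (S.fluArity F) → S.Obj) :
    (∃ d ∈ D.cond sgn F, d.Holds w z α xs) ↔
      ∃ p ∈ D.grounded sgn F α, p.1.Sat w z xs ∧ p.2.TrueAt w z := by
  simp only [EffDisj.holds_iff_ground, BAT.grounded, List.mem_filterMap]
  tauto

lemma mem_effectsOf {D : BAT S} {τ : TypeSet S} {E : Finset (Effect S)} {α : GAct S} {F : S.Flu}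
    {sgn : Bool} {d : Finset (Fml S (S.fluArity F))} :
    (⟨F, sgn, d⟩ : Effect S) ∈ effectsOf D τ E α ↔
      ∃ p ∈ D.grounded sgn F α, (p.2, E) ∈ τ ∧ d = {p.1} := by
  classical
  simp only [effectsOf, Finset.mem_biUnion, Finset.mem_univ, true_and, Finset.mem_image,
    Finset.mem_filter, List.mem_toFinset, Prod.exists]
  constructor
  · rintro ⟨F', s, a, κ, ⟨h, hτ⟩, he⟩
    cases he
    exact ⟨a, κ, h, hτ, rfl⟩
  · rintro ⟨a, κ, h, hτ, rfl⟩
    exact ⟨F, sgn, a, κ, ⟨h, hτ⟩, rfl⟩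

lemma affected_effectsOf (w : World S) (D : BAT S) (τ : TypeSet S) (E : Finset (Effect S))
    (α : GAct S) (F : S.Flu) (sgn : Bool) (xs : Fin (S.fluArity F) → S.Obj) :
    w.Affected (effectsOf D τ E α) F sgn xs ↔
      ∃ p ∈ D.grounded sgn F α, p.1.Sat w [] xs ∧ (p.2, E) ∈ τ := by
  simp only [World.Affected, mem_effectsOf]
  constructor
  · rintro ⟨_, ⟨p, hp, hτ, rfl⟩, h⟩
    exact ⟨p, hp, h _ (by simp), hτ⟩
  · rintro ⟨p, hp, h, hτ⟩
    exact ⟨_, ⟨p, hp, hτ, rfl⟩, by simpa using h⟩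

/-- If the effects `E` produce the values of the fluents after `z`, and `(τ, E)` decides the context
conditions as `w` does after `z`, then accumulating the effects of `α` produces the values after
`z · α`. -/
lemma update_accumulate_effectsOf {D : BAT S} {w : World S} (hw : D.Sat w) {τ : TypeSet S}
    {E : Finset (Effect S)} {z : Trace S} {α : GAct S}
    (hE : ∀ F xs, w F xs z ↔ w.update E F xs [])
    (hτ : ∀ sgn F, ∀ p ∈ D.grounded sgn F α, (p.2, E) ∈ τ ↔ p.2.TrueAt w z) (F : S.Flu)
    (xs : Fin (S.fluArity F) → S.Obj) :
    w F xs (z ++ [α]) ↔ w.update (accumulate E (effectsOf D τ E α)) F xs [] := by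
  have key : ∀ sgn, (w.update E).Affected (effectsOf D τ E α) F sgn xs ↔
      ∃ d ∈ D.cond sgn F, d.Holds w z α xs := by
    intro sgn
    rw [affected_effectsOf, BAT.exists_holds_iff]
    refine exists_congr fun p => and_congr_right fun hp => ?_
    rw [hτ sgn F p hp, Fml.sat_congr_world hE]
  rw [update_accumulate, hw.2 F z α xs]
  have h₁ := key true
  have h₂ := key false
  have h₃ := hE F xs
  change _ ↔ (_ ∧ ¬ _) ∨ _
  rw [h₁, h₂, ← h₃]
  exact or_comm

/-! ### Fluent depth and relevant effects -/

namespace BAT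

variable {D : BAT S}

lemma Acyclic.exists_hasPath_le (h : D.Acyclic) (F : S.Flu) : ∃ N, ∀ n, D.HasPath n F → n ≤ N := by
  let r : S.Flu → S.Flu → Prop := fun F F' => Relation.TransGen D.DepEdge F' F
  have : IsTrans S.Flu r := ⟨fun _ _ _ h₁ h₂ => h₂.trans h₁⟩
  have : Std.Irrefl r := ⟨h⟩
  have wf : WellFounded r := Finite.wellFounded_of_trans_of_irrefl r
  induction F using wf.induction with
  | _ F ih =>
    have : ∀ F', ∃ N, D.DepEdge F F' → ∀ n, D.HasPath n F' → n ≤ N := by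
      intro F'
      by_cases hF : D.DepEdge F F'
      · obtain ⟨N, hN⟩ := ih F' (.single hF)
        exact ⟨N, fun _ => hN⟩
      · exact ⟨0, fun h => absurd h hF⟩
    choose N hN using this
    refine ⟨Finset.univ.sup N + 1, fun n hn => ?_⟩
    cases n with
    | zero => omega
    | succ n =>
      obtain ⟨F', hF, hp⟩ := hn
      have h₁ := hN F' hF n hp
      have h₂ : N F' ≤ Finset.univ.sup N := Finset.le_sup (Finset.mem_univ F')
      omega

lemma Acyclic.bddAbove (h : D.Acyclic) (F : S.Flu) : BddAbove {n | D.HasPath n F} := by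
  obtain ⟨N, hN⟩ := h.exists_hasPath_le F
  exact ⟨N, hN⟩

lemma Acyclic.hasPath_fluentDepth (h : D.Acyclic) (F : S.Flu) : D.HasPath (D.fluentDepth F) F :=
  Nat.sSup_mem (s := {n | D.HasPath n F}) ⟨0, trivial⟩ (h.bddAbove F)

lemma Acyclic.fluentDepth_lt (h : D.Acyclic) {F F' : S.Flu} (he : D.DepEdge F F') :
    D.fluentDepth F' < D.fluentDepth F :=
  Nat.lt_of_succ_le (le_csSup (h.bddAbove F) ⟨F', he, h.hasPath_fluentDepth F'⟩)

lemma Acyclic.fluentDepth_le_depth (h : D.Acyclic) (F : S.Flu) : D.fluentDepth F ≤ D.depth := by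
  choose N hN using h.exists_hasPath_le
  refine le_csSup ⟨Finset.univ.sup N, ?_⟩ ⟨F, h.hasPath_fluentDepth F⟩
  rintro n ⟨F', hn⟩
  exact (hN F' n hn).trans (Finset.le_sup (Finset.mem_univ F'))

/-- The fluents in an instantiated effect descriptor of `F` are successors of `F` in the dependency
graph: instantiation only adds equalities. -/
lemma depEdge_of_mem_grounded {sgn : Bool} {F F' : S.Flu} {α : GAct S}
    {p : Fml S (S.fluArity F) × Fml S 0} (hp : p ∈ D.grounded sgn F α) (hF : F' ∈ p.1.fluents) :
    D.DepEdge F F' := by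
  obtain ⟨d, hd, hg⟩ := List.mem_filterMap.1 hp
  refine ⟨sgn, d, hd, ?_⟩
  unfold EffDisj.ground at hg
  split_ifs at hg with h
  cases hg
  rcases hF with hF | hF
  · rwa [Fml.fluents_subst] at hF
  · obtain ⟨φ, hφ, hF⟩ := Fml.fluents_conj _ hF
    obtain ⟨i, -, rfl⟩ := List.mem_map.1 hφ
    exact hF.elim

end BAT

lemma regress_congr {E E' : Finset (Effect S)} {n : ℕ} (φ : Fml S n)
    (h : ∀ F ∈ φ.fluents, ∀ sgn, descs E F sgn = descs E' F sgn) :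
    regress E φ = regress E' φ := by
  induction φ with
  | top => rfl
  | fluent F ts => simp only [regress, h F rfl]
  | eq s t => rfl
  | neg φ ih => simp only [regress, ih h]
  | and φ ψ ih₁ ih₂ =>
    simp only [regress, ih₁ fun F hF => h F (Or.inl hF), ih₂ fun F hF => h F (Or.inr hF)]
  | all φ ih => simp only [regress, ih h]
  | atMost k φ ih => simp only [regress, ih h]
  | atLeast k φ ih => simp only [regress, ih h]

namespace GologProgram

variable {G : GologProgram S}

lemma effectsBelow_mono {i j : ℕ} (h : i ≤ j) : G.effectsBelow i ⊆ G.effectsBelow j := by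
  induction h with
  | refl => exact subset_rfl
  | step _ ih => exact ih.trans fun e he => Or.inl (Or.inl he)

lemma mem_effectsBelow_of_lt {i j : ℕ} {e : Effect S} (h : e ∈ G.effectsBelow j)
    (hi : G.bat.fluentDepth e.flu < i) : e ∈ G.effectsBelow i := by
  induction j with
  | zero => exact h.elim
  | succ j ih =>
    by_cases h' : e ∈ G.effectsBelow j
    · exact ih h'
    · have hd : G.bat.fluentDepth e.flu = j := by
        rcases h with (h | ⟨F, ε, E, hF, -, -, rfl⟩) | ⟨F, φ, E, X, hF, -, -, -, rfl⟩
        · exact absurd h h'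
        · exact hF
        · exact hF
      exact effectsBelow_mono (by omega) h

open Classical in
/-- The effects in `E` on fluents of depth smaller than `j`. -/
noncomputable def restrict (G : GologProgram S) (E : Finset (Effect S)) (j : ℕ) :
    Finset (Effect S) :=
  E.filter (fun e => G.bat.fluentDepth e.flu < j)

lemma restrict_subset_effectsBelow {E : Finset (Effect S)}
    (hE : (E : Set (Effect S)) ⊆ G.relevantEffects) (j : ℕ) :
    (G.restrict E j : Set (Effect S)) ⊆ G.effectsBelow j := by
  intro e he
  have he := Finset.mem_filter.1 (Finset.mem_coe.1 he)
  exact mem_effectsBelow_of_lt (hE he.1) he.2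

/-- Regressing a descriptor of `F` only involves effects on fluents of smaller depth. -/
lemma regressDesc_restrict (hac : G.bat.Acyclic) (E : Finset (Effect S)) {sgn : Bool} {F : S.Flu}
    {ε : Fml S (S.fluArity F)} (hε : ε ∈ G.effDescs sgn F) :
    regressDesc (G.restrict E (G.bat.fluentDepth F)) {ε} = regressDesc E {ε} := by
  obtain ⟨α, -, κ, h⟩ := hε
  simp only [regressDesc, Finset.image_singleton]
  congr 1
  refine regress_congr ε fun F' hF' s => ?_
  have := hac.fluentDepth_lt (BAT.depEdge_of_mem_grounded h hF')
  ext D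
  simp [mem_descs, restrict, this]

lemma mem_relevantEffects_false (hac : G.bat.Acyclic) {F : S.Flu}
    {D : Finset (Fml S (S.fluArity F))} :
    (⟨F, false, D⟩ : Effect S) ∈ G.relevantEffects ↔
      ∃ ε ∈ G.effDescs false F, ∃ E : Finset (Effect S),
        (E : Set (Effect S)) ⊆ G.relevantEffects ∧ D = regressDesc E {ε} := by
  constructor
  · have : ∀ j, (⟨F, false, D⟩ : Effect S) ∈ G.effectsBelow j → ∃ i < j, ∃ ε ∈ G.effDescs false F,
        ∃ E : Finset (Effect S), (E : Set (Effect S)) ⊆ G.effectsBelow i ∧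
          D = regressDesc E {ε} := by
      intro j
      induction j with
      | zero => exact False.elim
      | succ j ih =>
        rintro ((h | ⟨F', ε, E, -, hε, hE, he⟩) | ⟨F', φ, E, X, -, -, -, -, he⟩)
        · obtain ⟨i, hi, h⟩ := ih h
          exact ⟨i, by omega, h⟩
        · cases he
          exact ⟨j, by omega, ε, hε, E, hE, rfl⟩
        · cases he
    intro h
    obtain ⟨i, hi, ε, hε, E, hE, hD⟩ := this _ h
    exact ⟨ε, hε, E, hE.trans (effectsBelow_mono hi.le), hD⟩
  · rintro ⟨ε, hε, E, hE, rfl⟩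
    refine effectsBelow_mono (Nat.succ_le_succ (hac.fluentDepth_le_depth F)) (Or.inl (Or.inr ?_))
    exact ⟨F, ε, _, rfl, hε, restrict_subset_effectsBelow hE _,
      by rw [regressDesc_restrict hac E hε]⟩

open Classical in
lemma mem_relevantEffects_true (hac : G.bat.Acyclic) {F : S.Flu}
    {D : Finset (Fml S (S.fluArity F))} :
    (⟨F, true, D⟩ : Effect S) ∈ G.relevantEffects ↔
      ∃ φ ∈ G.effDescs true F, ∃ E : Finset (Effect S),
        ∃ X : Finset (Fml S (S.fluArity F) × Finset (Effect S)),
        (E : Set (Effect S)) ⊆ G.relevantEffects ∧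
        (∀ p ∈ X, p.1 ∈ G.effDescs false F ∧ (p.2 : Set (Effect S)) ⊆ G.relevantEffects) ∧
        D = regressDesc E {φ} ∪
          X.image (fun p => Fml.neg (descFml (regressDesc p.2 {p.1}))) := by
  constructor
  · have : ∀ j, (⟨F, true, D⟩ : Effect S) ∈ G.effectsBelow j → ∃ i < j, ∃ φ ∈ G.effDescs true F,
        ∃ E : Finset (Effect S), ∃ X : Finset (Fml S (S.fluArity F) × Finset (Effect S)),
        (E : Set (Effect S)) ⊆ G.effectsBelow i ∧
        (∀ p ∈ X, p.1 ∈ G.effDescs false F ∧ (p.2 : Set (Effect S)) ⊆ G.effectsBelow i) ∧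
        D = regressDesc E {φ} ∪
          X.image (fun p => Fml.neg (descFml (regressDesc p.2 {p.1}))) := by
      intro j
      induction j with
      | zero => exact False.elim
      | succ j ih =>
        rintro ((h | ⟨F', ε, E, -, hε, hE, he⟩) | ⟨F', φ, E, X, -, hφ, hE, hX, he⟩)
        · obtain ⟨i, hi, h⟩ := ih h
          exact ⟨i, by omega, h⟩
        · cases he
        · cases he
          exact ⟨j, by omega, φ, hφ, E, X, hE, hX, rfl⟩
    intro h
    obtain ⟨i, hi, φ, hφ, E, X, hE, hX, hD⟩ := this _ h
    have hm := effectsBelow_mono (G := G) hi.le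
    exact ⟨φ, hφ, E, X, hE.trans hm, fun p hp => ⟨(hX p hp).1, (hX p hp).2.trans hm⟩, hD⟩
  · rintro ⟨φ, hφ, E, X, hE, hX, rfl⟩
    refine effectsBelow_mono (Nat.succ_le_succ (hac.fluentDepth_le_depth F)) (Or.inr ?_)
    refine ⟨F, φ, G.restrict E (G.bat.fluentDepth F),
      X.image (fun p => (p.1, G.restrict p.2 (G.bat.fluentDepth F))), rfl, hφ,
      restrict_subset_effectsBelow hE _, ?_, ?_⟩
    · intro p hp
      obtain ⟨p, hpX, rfl⟩ := Finset.mem_image.1 hp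
      exact ⟨(hX p hpX).1, restrict_subset_effectsBelow (hX p hpX).2 _⟩
    · rw [regressDesc_restrict hac E hφ, Finset.image_image]
      congr 2
      refine Finset.image_congr fun p hp => ?_
      simp only [Function.comp_apply]
      rw [regressDesc_restrict hac p.2 (hX p hp).1]

/-- The relevant effects are closed under accumulating the effects of program actions. -/
lemma accumulate_effectsOf_subset (hac : G.bat.Acyclic) (τ : TypeSet S) {E : Finset (Effect S)}
    (hE : (E : Set (Effect S)) ⊆ G.relevantEffects) {α : GAct S} (hα : α ∈ G.actions) :
    (accumulate E (effectsOf G.bat τ E α) : Set (Effect S)) ⊆ G.relevantEffects := by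
  classical
  have hdesc : ∀ {F sgn} {d : Finset (Fml S (S.fluArity F))},
      (⟨F, sgn, d⟩ : Effect S) ∈ effectsOf G.bat τ E α → ∃ ε ∈ G.effDescs sgn F, d = {ε} := by
    intro F sgn d h
    obtain ⟨p, hp, -, rfl⟩ := mem_effectsOf.1 h
    exact ⟨p.1, ⟨α, hα, p.2, hp⟩, rfl⟩
  rintro ⟨F, sgn, D⟩ he
  cases sgn with
  | false =>
    rcases mem_accumulate_false.1 he with ⟨d, hd, rfl⟩ | h
    · obtain ⟨ε, hε, rfl⟩ := hdesc hd
      exact (mem_relevantEffects_false hac).2 ⟨ε, hε, E, hE, rfl⟩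
    · exact hE h
  | true =>
    rcases mem_accumulate_true.1 he with ⟨d, hd, rfl⟩ | ⟨D', h, rfl⟩
    · obtain ⟨ε, hε, rfl⟩ := hdesc hd
      exact (mem_relevantEffects_true hac).2 ⟨ε, hε, E, ∅, hE, by simp, by simp⟩
    · obtain ⟨φ, hφ, E', X, hE', hX, rfl⟩ := (mem_relevantEffects_true hac).1 (hE h)
      -- The new negative descriptors are singletons `{ε}`, each regressed through `E`.
      let N : Finset (Fml S (S.fluArity F)) :=
        ((G.bat.grounded false F α).toFinset.filter (fun p => (p.2, E) ∈ τ)).image Prod.fst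
      have hN : descs (effectsOf G.bat τ E α) F false = N.image (fun ε => {ε}) := by
        ext d
        simp only [mem_descs, mem_effectsOf, N, Finset.mem_image, Finset.mem_filter,
          List.mem_toFinset]
        constructor
        · rintro ⟨p, hp, hτ, rfl⟩
          exact ⟨p.1, ⟨p, ⟨hp, hτ⟩, rfl⟩, rfl⟩
        · rintro ⟨_, ⟨p, ⟨hp, hτ⟩, rfl⟩, rfl⟩
          exact ⟨p, hp, hτ, rfl⟩
      refine (mem_relevantEffects_true hac).2
        ⟨φ, hφ, E', X ∪ N.image (fun ε => (ε, E)), hE', ?_, ?_⟩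
      · intro p hp
        rcases Finset.mem_union.1 hp with hp | hp
        · exact hX p hp
        · obtain ⟨ε, hε, rfl⟩ := Finset.mem_image.1 hp
          obtain ⟨p, hpN, rfl⟩ := Finset.mem_image.1 hε
          exact ⟨⟨α, hα, p.2, List.mem_toFinset.1 (Finset.mem_filter.1 hpN).1⟩, hE⟩
      · rw [hN, Finset.image_union, Finset.union_assoc]
        simp only [Finset.image_image]
        rfl

/-! ### Effects along a trace -/

/-- The effects accumulated along a trace according to the type `τ`. -/
noncomputable def effectsAlong (G : GologProgram S) (τ : TypeSet S) (z : Trace S) :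
    Finset (Effect S) :=
  z.foldl (fun E α => accumulate E (effectsOf G.bat τ E α)) ∅

lemma effectsAlong_append (τ : TypeSet S) (z : Trace S) (α : GAct S) :
    G.effectsAlong τ (z ++ [α]) =
      accumulate (G.effectsAlong τ z) (effectsOf G.bat τ (G.effectsAlong τ z) α) := by
  simp [effectsAlong]

lemma effectsAlong_subset (hac : G.bat.Acyclic) (τ : TypeSet S) {z : Trace S}
    (hz : ∀ α ∈ z, α ∈ G.actions) : (G.effectsAlong τ z : Set (Effect S)) ⊆ G.relevantEffects := by
  induction z using List.reverseRecOn with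
  | nil => simp [effectsAlong]
  | append_singleton z α ih =>
    rw [effectsAlong_append]
    exact accumulate_effectsOf_subset hac τ (ih fun β hβ => hz β (by simp [hβ])) (hz α (by simp))

variable {Φ : LTLf S} {w : World S}

lemma mem_typeOf {ψ : Fml S 0} {E : Finset (Effect S)} : (ψ, E) ∈ G.typeOf Φ w ↔
    (ψ, E) ∈ G.typeElements Φ ∧ (regress E ψ).TrueAt w [] :=
  Iff.rfl

/-- The effects accumulated along `z` in the type of `w` produce the values of all fluents after
`z`. -/
lemma world_iff_update_effectsAlong (hac : G.bat.Acyclic) (hw : G.bat.Sat w) {z : Trace S}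
    (hz : ∀ α ∈ z, α ∈ G.actions) (F : S.Flu) (xs : Fin (S.fluArity F) → S.Obj) :
    w F xs z ↔ w.update (G.effectsAlong (G.typeOf Φ w) z) F xs [] := by
  induction z using List.reverseRecOn generalizing F xs with
  | nil => exact (update_empty w F xs []).symm
  | append_singleton z α ih =>
    have hz' : ∀ β ∈ z, β ∈ G.actions := fun β hβ => hz β (by simp [hβ])
    rw [effectsAlong_append]
    refine update_accumulate_effectsOf hw (fun F xs => ih hz' F xs) (fun sgn F p hp => ?_) F xs
    have hκ : (p.2, G.effectsAlong (G.typeOf Φ w) z) ∈ G.typeElements Φ :=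
      ⟨.contextCond (hz α (by simp)) hp, effectsAlong_subset hac _ hz'⟩
    rw [mem_typeOf, and_iff_right hκ, trueAt_regress]
    exact (Fml.sat_congr_world (ih hz') _ _).symm

/-- The type of `w` together with the effects accumulated along `z` decides every context formula as
`w` does after `z`. -/
lemma mem_typeOf_iff (hac : G.bat.Acyclic) (hw : G.bat.Sat w) {z : Trace S}
    (hz : ∀ α ∈ z, α ∈ G.actions) {ψ : Fml S 0} (hψ : G.Context Φ ψ) :
    (ψ, G.effectsAlong (G.typeOf Φ w) z) ∈ G.typeOf Φ w ↔ ψ.TrueAt w z := by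
  have h : (ψ, G.effectsAlong (G.typeOf Φ w) z) ∈ G.typeElements Φ :=
    ⟨hψ, effectsAlong_subset hac _ hz⟩
  rw [mem_typeOf, and_iff_right h, trueAt_regress]
  exact (Fml.sat_congr_world (world_iff_update_effectsAlong hac hw hz) _ _).symm

lemma isType_typeOf (hw : G.bat.SatInitial w) : G.IsType Φ (G.typeOf Φ w) := by
  refine ⟨fun p hp => hp.1, fun ψ hψ E hE => ?_, w, hw, fun p hp => hp.2⟩
  by_cases h : (regress E ψ).TrueAt w []
  · exact Or.inl ⟨⟨hψ, hE⟩, h⟩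
  · exact Or.inr ⟨⟨hψ.neg, hE⟩, h⟩

/-- Every type is the type of any world that realizes it. -/
lemma IsType.exists_eq_typeOf {τ : TypeSet S} (hτ : G.IsType Φ τ) : ∃ w, τ = G.typeOf Φ w := by
  obtain ⟨hsub, hcompl, w, -, hw⟩ := hτ
  refine ⟨w, Set.Subset.antisymm (fun p hp => ⟨hsub hp, hw p hp⟩) ?_⟩
  rintro ⟨ψ, E⟩ ⟨h, ht⟩
  exact (hcompl ψ h.1 E h.2).resolve_right fun hn => hw _ hn ht

end GologProgram

/-! ### Finite-trace semantics of the tail normal form -/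

/-- Structural induction, with a case name for `until` that is not a keyword. -/
@[elab_as_elim, induction_eliminator]
lemma LTLf.induction {motive : LTLf S → Prop} (atom : ∀ φ, motive (.atom φ))
    (not : ∀ Φ, motive Φ → motive (.not Φ))
    (and : ∀ Φ₁ Φ₂, motive Φ₁ → motive Φ₂ → motive (.and Φ₁ Φ₂))
    (next : ∀ Φ, motive Φ → motive (.next Φ))
    (untl : ∀ Φ₁ Φ₂, motive Φ₁ → motive Φ₂ → motive (.until Φ₁ Φ₂)) (Φ : LTLf S) : motive Φ :=
  LTLf.rec atom not and next untl Φ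

/-- Structural induction, with a case name for `until` that is not a keyword. -/
@[elab_as_elim, induction_eliminator]
lemma TForm.induction {motive : TForm S → Prop} (tt : motive .tt) (ff : motive .ff)
    (lit : ∀ b φ, motive (.lit b φ)) (tail : ∀ b, motive (.tail b))
    (and : ∀ Φ₁ Φ₂, motive Φ₁ → motive Φ₂ → motive (.and Φ₁ Φ₂))
    (or : ∀ Φ₁ Φ₂, motive Φ₁ → motive Φ₂ → motive (.or Φ₁ Φ₂))
    (next : ∀ Φ, motive Φ → motive (.next Φ))
    (untl : ∀ Φ₁ Φ₂, motive Φ₁ → motive Φ₂ → motive (.until Φ₁ Φ₂))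
    (release : ∀ Φ₁ Φ₂, motive Φ₁ → motive Φ₂ → motive (.release Φ₁ Φ₂)) (Ψ : TForm S) :
    motive Ψ :=
  TForm.rec tt ff lit tail and or next untl release Ψ

/-- Strong until over predicates of the past and the remaining trace: `Q` holds after some prefix of
the remaining trace, and `P` after every shorter one. -/
def UntilSem (P Q : Trace S → Trace S → Prop) (z z' : Trace S) : Prop :=
  ∃ k ≤ z'.length, Q (z ++ z'.take k) (z'.drop k) ∧ ∀ i < k, P (z ++ z'.take i) (z'.drop i)

lemma untilSem_iff (P Q : Trace S → Trace S → Prop) (z z' : Trace S) :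
    UntilSem P Q z z' ↔
      Q z z' ∨ (P z z' ∧ ∃ α z'', z' = α :: z'' ∧ UntilSem P Q (z ++ [α]) z'') := by
  constructor
  · rintro ⟨k, hk, hQ, hP⟩
    cases k with
    | zero => exact Or.inl (by simpa using hQ)
    | succ k =>
      cases z' with
      | nil => simp at hk
      | cons α z'' =>
        refine Or.inr ⟨by simpa using hP 0 (by omega), α, z'', rfl, k, by simpa using hk,
          by simpa using hQ, fun i hi => ?_⟩
        simpa using hP (i + 1) (by omega)
  · rintro (hQ | ⟨hP, α, z'', rfl, k, hk, hQ, hi⟩)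
    · exact ⟨0, by simp, by simpa using hQ, fun i hi => by omega⟩
    · refine ⟨k + 1, by simpa using hk, by simpa using hQ, fun i hik => ?_⟩
      cases i with
      | zero => simpa using hP
      | succ i => simpa using hi i (by omega)

namespace TForm

/-- Truth of a `TForm` after the past `z` with the remaining trace `z'`; `Tail` marks the end of the
trace. Release is read strongly, that is, the first argument has to become true at some point: this
makes the unfolding by `xnf` valid for all formulas, and on tail normal forms it agrees with the
usual reading, since there the first argument of a release has the disjunct `Tail`. -/
def Sat (w : World S) : TForm S → Trace S → Trace S → Prop
  | tt, _, _ => True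
  | ff, _, _ => False
  | lit b φ, z, _ => φ.TrueAt w z ↔ b = true
  | tail b, _, z' => z' = [] ↔ b = true
  | and Φ₁ Φ₂, z, z' => Sat w Φ₁ z z' ∧ Sat w Φ₂ z z'
  | or Φ₁ Φ₂, z, z' => Sat w Φ₁ z z' ∨ Sat w Φ₂ z z'
  | next Φ, z, z' => ∃ α z'', z' = α :: z'' ∧ Sat w Φ (z ++ [α]) z''
  | .until Φ₁ Φ₂, z, z' => UntilSem (Sat w Φ₁) (Sat w Φ₂) z z'
  | release Φ₁ Φ₂, z, z' => UntilSem (Sat w Φ₂) (fun y y' => Sat w Φ₁ y y' ∧ Sat w Φ₂ y y') z z'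

variable {w : World S}

lemma sat_xnf (Ψ : TForm S) (z z' : Trace S) : Ψ.xnf.Sat w z z' ↔ Ψ.Sat w z z' := by
  induction Ψ generalizing z z' with
  | tt | ff | lit | tail | next => rfl
  | and Φ₁ Φ₂ ih₁ ih₂ | or Φ₁ Φ₂ ih₁ ih₂ => simp only [xnf, Sat, ih₁, ih₂]
  | untl Φ₁ Φ₂ ih₁ ih₂ =>
    simp only [xnf, Sat, ih₁, ih₂]
    rw [untilSem_iff (Sat w Φ₁)]
  | release Φ₁ Φ₂ ih₁ ih₂ =>
    simp only [xnf, Sat, ih₁, ih₂]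
    rw [untilSem_iff (Sat w Φ₂)]
    tauto

lemma sat_foldr_and (l : List (TForm S)) (z z' : Trace S) :
    (l.foldr and tt).Sat w z z' ↔ ∀ θ ∈ l, θ.Sat w z z' := by
  induction l with
  | nil => simp [Sat]
  | cons θ l ih => simp [Sat, ih]

lemma sat_bigAnd (χ : Finset (TForm S)) (z z' : Trace S) :
    (bigAnd χ).Sat w z z' ↔ ∀ θ ∈ χ, θ.Sat w z z' := by
  simp [bigAnd, sat_foldr_and]

end TForm

/-- On tail normal forms, `Tail` agrees with weak next and release of the finite-trace semantics. -/
lemma LTLf.sat_tnft_nnf (w : World S) (Φ : LTLf S) (b : Bool) (z z' : Trace S) :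
    (Φ.nnf b).tnft.Sat w z z' ↔ (Φ.Sat w z z' ↔ b = true) := by
  induction Φ generalizing b z z' with
  | atom φ => rfl
  | not Φ ih =>
    rw [LTLf.nnf, ih]
    cases b <;> simp [LTLf.Sat]
  | and Φ₁ Φ₂ ih₁ ih₂ =>
    cases b <;> simp only [LTLf.nnf, NForm.tnft, TForm.Sat, ih₁, ih₂, LTLf.Sat] <;> (simp; try tauto)
  | next Φ ih =>
    cases b <;> simp only [LTLf.nnf, NForm.tnft, TForm.Sat, ih, LTLf.Sat] <;> cases z' <;> simp
  | untl Φ₁ Φ₂ ih₁ ih₂ =>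
    cases b with
    | true =>
      simp only [LTLf.nnf, NForm.tnft, TForm.Sat, ih₁, ih₂, LTLf.Sat, iff_true, UntilSem,
        Bool.false_eq_true, iff_false]
      refine exists_congr fun k => and_congr_right fun hk => and_congr_right fun _ =>
        forall_congr' fun i => imp_congr_right fun hi => and_iff_right ?_
      simp only [List.drop_eq_nil_iff]
      omega
    | false =>
      simp only [LTLf.nnf, NForm.tnft, TForm.Sat, ih₁, ih₂, LTLf.Sat, Bool.false_eq_true, iff_false,
        iff_true, UntilSem, List.drop_eq_nil_iff]
      constructor
      · rintro ⟨k, hk, ⟨h₁, h₂⟩, hi⟩ ⟨j, hj, hj₂, hj₁⟩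
        have hkj : k < j := by
          by_contra hle
          rcases (not_lt.1 hle).lt_or_eq with h | rfl
          · exact hi j h hj₂
          · exact h₂ hj₂
        rcases h₁ with h₁ | h₁
        · omega
        · exact h₁ (hj₁ k hkj)
      · intro h
        -- The release is discharged where `Φ₁` fails first, or else at the end of the trace.
        have hex : ∃ k, z'.length ≤ k ∨ ¬ Φ₁.Sat w (z ++ z'.take k) (z'.drop k) :=
          ⟨z'.length, Or.inl le_rfl⟩
        classical
        have hmin : ∀ i < Nat.find hex, Φ₁.Sat w (z ++ z'.take i) (z'.drop i) := fun i hi => by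
          have := Nat.find_min hex hi
          tauto
        have hle : Nat.find hex ≤ z'.length := Nat.find_min' hex (Or.inl le_rfl)
        refine ⟨Nat.find hex, hle, ⟨Nat.find_spec hex, fun h₂ => h ⟨_, hle, h₂, hmin⟩⟩, ?_⟩
        exact fun i hi h₂ => h ⟨i, by omega, h₂, fun j hj => hmin j (hj.trans hi)⟩

/-- The conjunct of the tail normal form that requires the trace to end. -/
def TForm.eventuallyTail : TForm S := .until .tt (.tail true)

lemma TForm.sat_eventuallyTail (w : World S) (z z' : Trace S) :
    TForm.eventuallyTail.Sat w z z' :=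
  ⟨z'.length, le_rfl, by simp [TForm.Sat], fun _ _ => trivial⟩

lemma LTLf.sat_tnf (w : World S) (Φ : LTLf S) (z z' : Trace S) :
    Φ.tnf.Sat w z z' ↔ Φ.Sat w z z' := by
  change _ ∧ TForm.eventuallyTail.Sat w z z' ↔ _
  rw [and_iff_left (TForm.sat_eventuallyTail w z z'), sat_tnft_nnf]
  simp

/-! ### Subformulas and propositional atoms -/

namespace TForm

lemma self_mem_closure (Ψ : TForm S) : Ψ ∈ Ψ.closure := by
  cases Ψ <;> simp [closure]

lemma closure_subset {Ψ θ : TForm S} (h : θ ∈ Ψ.closure) : θ.closure ⊆ Ψ.closure := by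
  induction Ψ with
  | tt | ff | lit | tail => cases h; exact subset_rfl
  | and Φ₁ Φ₂ ih₁ ih₂ | or Φ₁ Φ₂ ih₁ ih₂ | untl Φ₁ Φ₂ ih₁ ih₂ | release Φ₁ Φ₂ ih₁ ih₂ =>
    rcases h with (rfl | h) | h
    · exact subset_rfl
    · exact (ih₁ h).trans fun _ hx => Or.inl (Or.inr hx)
    · exact (ih₂ h).trans fun _ hx => Or.inr hx
  | next Φ ih =>
    rcases h with rfl | h
    · exact subset_rfl
    · exact (ih h).trans fun _ hx => Or.inr hx

lemma closure_finite (Ψ : TForm S) : Ψ.closure.Finite := by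
  induction Ψ with
  | tt | ff | lit | tail => exact Set.finite_singleton _
  | and Φ₁ Φ₂ ih₁ ih₂ | or Φ₁ Φ₂ ih₁ ih₂ | untl Φ₁ Φ₂ ih₁ ih₂ | release Φ₁ Φ₂ ih₁ ih₂ =>
    exact ((Set.finite_singleton _).union ih₁).union ih₂
  | next Φ ih => exact (Set.finite_singleton _).union ih

/-- The atoms of the next normal form come from subformulas. -/
lemma mem_propAtoms_xnf {Ψ p : TForm S} (hp : p ∈ Ψ.xnf.propAtoms) :
    (∀ φ, p = lit true φ → ∃ b, lit b φ ∈ Ψ.closure) ∧ (∀ θ, p = next θ → θ ∈ Ψ.closure) := by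
  induction Ψ with
  | tt | ff => exact hp.elim
  | lit b φ =>
    cases hp
    exact ⟨fun φ h => ⟨b, by cases h; rfl⟩, fun θ h => (by cases h)⟩
  | tail b =>
    cases hp
    exact ⟨fun φ h => (by cases h), fun θ h => (by cases h)⟩
  | and Φ₁ Φ₂ ih₁ ih₂ | or Φ₁ Φ₂ ih₁ ih₂ =>
    rcases hp with hp | hp
    · exact ⟨fun φ h => ((ih₁ hp).1 φ h).imp fun _ hb => Or.inl (Or.inr hb),
        fun θ h => Or.inl (Or.inr ((ih₁ hp).2 θ h))⟩
    · exact ⟨fun φ h => ((ih₂ hp).1 φ h).imp fun _ hb => Or.inr hb,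
        fun θ h => Or.inr ((ih₂ hp).2 θ h)⟩
  | next Φ ih =>
    cases hp
    refine ⟨fun φ h => (by cases h), fun θ h => ?_⟩
    cases h
    exact Or.inr (self_mem_closure Φ)
  | untl Φ₁ Φ₂ ih₁ ih₂ | release Φ₁ Φ₂ ih₁ ih₂ =>
    rcases hp with hp | hp | hp
    · exact ⟨fun φ h => ((ih₂ hp).1 φ h).imp fun _ hb => Or.inr hb,
        fun θ h => Or.inr ((ih₂ hp).2 θ h)⟩
    · exact ⟨fun φ h => ((ih₁ hp).1 φ h).imp fun _ hb => Or.inl (Or.inr hb),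
        fun θ h => Or.inl (Or.inr ((ih₁ hp).2 θ h))⟩
    · cases hp
      refine ⟨fun φ h => (by cases h), fun θ h => ?_⟩
      cases h
      exact self_mem_closure _

lemma mem_propAtoms_xnf_bigAnd {χ : Finset (TForm S)} {p : TForm S} :
    p ∈ (bigAnd χ).xnf.propAtoms ↔ ∃ θ ∈ χ, p ∈ θ.xnf.propAtoms := by
  have : ∀ l : List (TForm S), p ∈ (l.foldr and tt).xnf.propAtoms ↔
      ∃ θ ∈ l, p ∈ θ.xnf.propAtoms := by
    intro l
    induction l with
    | nil => simp [xnf, propAtoms]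
    | cons θ l ih => simp [xnf, propAtoms, ih]
  simpa [bigAnd] using this χ.toList

end TForm

lemma LTLf.mem_atoms_of_lit_mem_closure {Φ : LTLf S} {b b' : Bool} {φ : Fml S 0}
    (h : TForm.lit b φ ∈ (Φ.nnf b').tnft.closure) : φ ∈ Φ.atoms := by
  induction Φ generalizing b' with
  | atom ψ => cases h; rfl
  | not Φ ih => exact ih h
  | and Φ₁ Φ₂ ih₁ ih₂ =>
    cases b' <;> rcases h with (h | h) | h
    · cases h
    · exact Or.inl (ih₁ h)
    · exact Or.inr (ih₂ h)
    · cases h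
    · exact Or.inl (ih₁ h)
    · exact Or.inr (ih₂ h)
  | next Φ ih =>
    cases b' <;> rcases h with (h | h) | h | h
    any_goals cases h
    · exact ih h
    · exact ih h
  | untl Φ₁ Φ₂ ih₁ ih₂ =>
    cases b' <;> rcases h with (h | (h | h) | h) | h
    any_goals cases h
    · exact Or.inl (ih₁ h)
    · exact Or.inr (ih₂ h)
    · exact Or.inl (ih₁ h)
    · exact Or.inr (ih₂ h)

/-- The formulas whose next normal form only has atoms that are fluent sentences of `Φ`, `Tail`, or
`X θ` with `θ` a subformula of the tail normal form of `Φ`. -/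
def LTLf.Tracked (Φ : LTLf S) (Ψ : TForm S) : Prop :=
  (∀ φ, .lit true φ ∈ Ψ.xnf.propAtoms → φ ∈ Φ.atoms) ∧
  ∀ θ, .next θ ∈ Ψ.xnf.propAtoms → θ ∈ Φ.tnf.closure

lemma LTLf.tracked_of_mem_closure {Φ : LTLf S} {θ : TForm S} (h : θ ∈ Φ.tnf.closure) :
    Φ.Tracked θ := by
  refine ⟨fun φ hφ => ?_, fun θ' hθ' =>
    TForm.closure_subset h ((TForm.mem_propAtoms_xnf hθ').2 θ' rfl)⟩
  obtain ⟨b, hb⟩ := (TForm.mem_propAtoms_xnf hφ).1 φ rfl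
  rcases TForm.closure_subset h hb with (h | h) | (h | h) | h
  any_goals cases h
  exact mem_atoms_of_lit_mem_closure h

lemma LTLf.tracked_tnf (Φ : LTLf S) : Φ.Tracked Φ.tnf :=
  tracked_of_mem_closure (TForm.self_mem_closure _)

lemma LTLf.tracked_bigAnd {Φ : LTLf S} {χ : Finset (TForm S)}
    (h : (χ : Set (TForm S)) ⊆ Φ.tnf.closure) : Φ.Tracked (TForm.bigAnd χ) := by
  refine ⟨fun φ hφ => ?_, fun θ hθ => ?_⟩
  · obtain ⟨ψ, hψ, hp⟩ := TForm.mem_propAtoms_xnf_bigAnd.1 hφ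
    exact (tracked_of_mem_closure (h hψ)).1 φ hp
  · obtain ⟨ψ, hψ, hp⟩ := TForm.mem_propAtoms_xnf_bigAnd.1 hθ
    exact (tracked_of_mem_closure (h hψ)).2 θ hp

lemma trackSet_subset_closure {Φ : LTLf S} {Ψ : TForm S} (hΨ : Φ.Tracked Ψ) {τ : TypeSet S}
    {E : Finset (Effect S)} {q : Finset (TForm S) × Bool} (hq : q ∈ trackSet τ E Ψ) :
    (q.1 : Set (TForm S)) ⊆ Φ.tnf.closure := by
  obtain ⟨P, ⟨hP, -⟩, -, hX, -⟩ := hq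
  rw [hX]
  intro θ hθ
  refine hΨ.2 θ (hP _ ?_)
  rw [show P (.next θ) = some true from hθ]
  simp

/-! ### Tracking satisfaction along a trace -/

/-- The obligations recorded in `q` after `z` are met by the remaining trace `z'`: it is empty if
`Tail` was guessed, and otherwise nonempty with all next obligations true one step later. -/
def Meets (w : World S) (q : Finset (TForm S) × Bool) (z z' : Trace S) : Prop :=
  (q.2 = true ∧ q.1 = ∅ ∧ z' = []) ∨
    (q.2 = false ∧ ∃ α z'', z' = α :: z'' ∧ (TForm.bigAnd q.1).Sat w (z ++ [α]) z'')

/-- One step of soundness: meeting the obligations of some satisfying assignment suffices. -/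
lemma sat_of_meets {w : World S} {τ : TypeSet S} {E : Finset (Effect S)} {Ψ : TForm S}
    {z z' : Trace S} (hτ : ∀ ψ, (ψ, E) ∈ τ → ψ.TrueAt w z) {q : Finset (TForm S) × Bool}
    (hq : q ∈ trackSet τ E Ψ) (hm : Meets w q z z') : Ψ.Sat w z z' := by
  obtain ⟨P, ⟨-, hsat⟩, hlit, hX, hT⟩ := hq
  rw [← TForm.sat_xnf]
  have hnext : ∀ θ, P (.next θ) = some true → (TForm.next θ).Sat w z z' := by
    intro θ hθ
    have hθ : θ ∈ q.1 := by
      rw [← Finset.mem_coe, hX]; exact hθ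
    rcases hm with ⟨-, h, -⟩ | ⟨-, α, z'', rfl, h⟩
    · simp [h] at hθ
    · exact ⟨α, z'', rfl, (TForm.sat_bigAnd _ _ _).1 h θ hθ⟩
  have htail : P (.tail true) = some true ↔ z' = [] := by
    have : q.2 = true ↔ P (.tail true) = some true := by simp [hT, TForm.hasTail]
    rw [← this]
    rcases hm with ⟨h, -, rfl⟩ | ⟨h, α, z'', rfl, -⟩ <;> simp [h]
  have key : ∀ Θ : TForm S, Θ.xnf.PropSat P → Θ.xnf.Sat w z z' := by
    intro Θ
    induction Θ with
    | tt => exact fun _ => trivial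
    | ff => exact id
    | lit b φ =>
      intro h
      cases b with
      | true => exact iff_of_true (hτ _ (hlit _ (Or.inl h))) rfl
      | false => exact iff_of_false (hτ _ (hlit _ (Or.inr ⟨φ, h, rfl⟩))) (by simp)
    | tail b =>
      intro h
      change P _ = _ at h
      cases b with
      | true => exact iff_of_true (htail.1 h) rfl
      | false =>
        refine iff_of_false (fun hz => ?_) (by simp)
        simp [htail.2 hz] at h
    | and Φ₁ Φ₂ ih₁ ih₂ => exact fun h => ⟨ih₁ h.1, ih₂ h.2⟩
    | or Φ₁ Φ₂ ih₁ ih₂ => exact fun h => h.imp ih₁ ih₂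
    | next Φ => exact hnext Φ
    | untl Φ₁ Φ₂ ih₁ ih₂ => exact fun h => h.imp ih₂ fun h => ⟨ih₁ h.1, hnext _ h.2⟩
    | release Φ₁ Φ₂ ih₁ ih₂ => exact fun h => ⟨ih₂ h.1, h.2.imp ih₁ (hnext _)⟩
  exact key Ψ hsat

/-- One step of completeness: the assignment that records the actual truth values of all atoms. Since
the atom `Tail` and the obligation to reach it occur in the next normal form, the assignment decides
`Tail`, and passes the obligation on. -/
lemma exists_meets {w : World S} {τ : TypeSet S} {E : Finset (Effect S)} {Φ : LTLf S} {Ψ : TForm S}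
    {z z' : Trace S} (hΨ : Φ.Tracked Ψ) (hτ : ∀ φ ∈ Φ.atoms, φ.TrueAt w z → (φ, E) ∈ τ)
    (hτn : ∀ φ ∈ Φ.atoms, ¬ φ.TrueAt w z → (φ.neg, E) ∈ τ)
    (htail : .tail true ∈ Ψ.xnf.propAtoms) (hev : .next .eventuallyTail ∈ Ψ.xnf.propAtoms)
    (hsat : Ψ.Sat w z z') :
    ∃ q ∈ trackSet τ E Ψ, Meets w q z z' ∧ (z' ≠ [] → .eventuallyTail ∈ q.1) := by
  classical
  let P : TForm S → Option Bool := fun p =>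
    if p ∈ Ψ.xnf.propAtoms then some (decide (p.Sat w z z')) else none
  have hP : ∀ {p b}, P p = some b ↔ p ∈ Ψ.xnf.propAtoms ∧ (p.Sat w z z' ↔ b = true) := by
    intro p b
    by_cases h : p ∈ Ψ.xnf.propAtoms
    · cases b <;> simp [P, h]
    · simp [P, h]
  have hfin : (TForm.nexts P).Finite :=
    Φ.tnf.closure_finite.subset fun θ hθ => hΨ.2 θ (hP.1 hθ).1
  have key : ∀ Θ : TForm S, Θ.propAtoms ⊆ Ψ.xnf.propAtoms → Θ.Sat w z z' → Θ.PropSat P := by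
    intro Θ
    induction Θ with
    | tt => exact fun _ _ => trivial
    | ff => exact fun _ h => h
    | lit b φ => exact fun h hs => hP.2 ⟨h rfl, by simpa [TForm.Sat] using hs⟩
    | tail b => exact fun h hs => hP.2 ⟨h rfl, by simpa [TForm.Sat] using hs⟩
    | and Φ₁ Φ₂ ih₁ ih₂ =>
      exact fun h hs => ⟨ih₁ (fun _ hp => h (Or.inl hp)) hs.1, ih₂ (fun _ hp => h (Or.inr hp)) hs.2⟩
    | or Φ₁ Φ₂ ih₁ ih₂ =>
      exact fun h hs => hs.imp (ih₁ fun _ hp => h (Or.inl hp)) (ih₂ fun _ hp => h (Or.inr hp))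
    | next Φ => exact fun h hs => hP.2 ⟨h rfl, by simpa using hs⟩
    | untl Φ₁ Φ₂ => exact fun h hs => hP.2 ⟨h rfl, by simpa using hs⟩
    | release Φ₁ Φ₂ => exact fun h hs => hP.2 ⟨h rfl, by simpa using hs⟩
  refine ⟨(hfin.toFinset, TForm.hasTail P), ⟨P, ⟨fun p hp => ?_, ?_⟩, ?_, by simp, rfl⟩, ?_, ?_⟩
  · by_contra h
    exact hp (by simp [P, h])
  · exact key _ subset_rfl ((TForm.sat_xnf ..).2 hsat)
  · rintro ψ (h | ⟨φ, h, rfl⟩)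
    · obtain ⟨hm, hs⟩ := hP.1 h
      exact hτ _ (hΨ.1 _ hm) (by simpa [TForm.Sat] using hs)
    · obtain ⟨hm, hs⟩ := hP.1 h
      exact hτn _ (hΨ.1 _ hm) (by simpa [TForm.Sat] using hs)
  · have hT : TForm.hasTail P = true ↔ z' = [] := by
      simp [TForm.hasTail, hP, htail, TForm.Sat]
    cases z' with
    | nil =>
      refine Or.inl ⟨hT.2 rfl, ?_, rfl⟩
      ext θ
      simp [TForm.nexts, hP, TForm.Sat]
    | cons α z'' =>
      refine Or.inr ⟨by simpa using hT, α, z'', rfl, (TForm.sat_bigAnd _ _ _).2 fun θ hθ => ?_⟩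
      have hθ : P (.next θ) = some true := by simpa [TForm.nexts] using hθ
      obtain ⟨_, _, h, hs⟩ := (hP.1 hθ).2.2 rfl
      cases h
      exact hs
  · intro hz
    obtain ⟨α, z'', rfl⟩ := List.exists_cons_of_ne_nil hz
    simp only [Set.Finite.mem_toFinset]
    refine hP.2 ⟨hev, iff_of_true ⟨α, z'', rfl, TForm.sat_eventuallyTail ..⟩ rfl⟩

namespace GologProgram

variable {G : GologProgram S} {Φ : LTLf S} {w : World S}

/-- One step of the component that tracks the temporal formula: `E` are the effects after the
step. -/
def trackStep (τ : TypeSet S) (E : Finset (Effect S)) (A : Set (Finset (TForm S) × Bool)) :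
    Set (Finset (TForm S) × Bool) :=
  {q | ∃ q₁ ∈ A, q₁.2 = false ∧ q ∈ trackSet τ E (TForm.bigAnd q₁.1)}

/-- The effects and the tracked obligations of the arena state reached by a trace. -/
noncomputable def runAlong (G : GologProgram S) (Φ : LTLf S) (τ : TypeSet S) (z : Trace S) :
    Finset (Effect S) × Set (Finset (TForm S) × Bool) :=
  z.foldl (fun p α => (accumulate p.1 (effectsOf G.bat τ p.1 α),
    trackStep τ (accumulate p.1 (effectsOf G.bat τ p.1 α)) p.2)) (∅, trackSet τ ∅ Φ.tnf)

lemma runAlong_fst (τ : TypeSet S) (z : Trace S) :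
    (G.runAlong Φ τ z).1 = G.effectsAlong τ z := by
  induction z using List.reverseRecOn with
  | nil => rfl
  | append_singleton z α ih =>
    rw [effectsAlong_append, ← ih]
    simp [runAlong]

/-- The obligations tracked along a trace. -/
noncomputable def trackAlong (G : GologProgram S) (Φ : LTLf S) (τ : TypeSet S) (z : Trace S) :
    Set (Finset (TForm S) × Bool) :=
  (G.runAlong Φ τ z).2

lemma trackAlong_append (τ : TypeSet S) (z : Trace S) (α : GAct S) :
    G.trackAlong Φ τ (z ++ [α]) =
      trackStep τ (G.effectsAlong τ (z ++ [α])) (G.trackAlong Φ τ z) := by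
  rw [effectsAlong_append, ← runAlong_fst (Φ := Φ)]
  simp [trackAlong, runAlong]

lemma trackStep_subset_closure {τ : TypeSet S} {E : Finset (Effect S)}
    {A : Set (Finset (TForm S) × Bool)} (hA : ∀ q ∈ A, (q.1 : Set (TForm S)) ⊆ Φ.tnf.closure)
    {q : Finset (TForm S) × Bool} (hq : q ∈ trackStep τ E A) :
    (q.1 : Set (TForm S)) ⊆ Φ.tnf.closure := by
  obtain ⟨q₁, h₁, -, hq⟩ := hq
  exact trackSet_subset_closure (LTLf.tracked_bigAnd (hA q₁ h₁)) hq

lemma trackAlong_subset_closure (τ : TypeSet S) (z : Trace S) :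
    ∀ q ∈ G.trackAlong Φ τ z, (q.1 : Set (TForm S)) ⊆ Φ.tnf.closure := by
  induction z using List.reverseRecOn with
  | nil => exact fun q hq => trackSet_subset_closure Φ.tracked_tnf hq
  | append_singleton z α ih =>
    intro q hq
    rw [trackAlong_append] at hq
    exact trackStep_subset_closure ih hq

lemma sat_of_mem_trackAlong (hac : G.bat.Acyclic) (hw : G.bat.Sat w) {z z' : Trace S}
    (hz : ∀ α ∈ z, α ∈ G.actions) {q : Finset (TForm S) × Bool}
    (hq : q ∈ G.trackAlong Φ (G.typeOf Φ w) z) (hm : Meets w q z z') :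
    Φ.tnf.Sat w [] (z ++ z') := by
  have hτ : ∀ {y : Trace S}, (∀ α ∈ y, α ∈ G.actions) → ∀ ψ,
      (ψ, G.effectsAlong (G.typeOf Φ w) y) ∈ G.typeOf Φ w → ψ.TrueAt w y :=
    fun hy ψ h => (mem_typeOf_iff hac hw hy h.1.1).1 h
  induction z using List.reverseRecOn generalizing z' q with
  | nil => exact sat_of_meets (hτ (y := []) (by simp)) hq hm
  | append_singleton z α ih =>
    rw [trackAlong_append] at hq
    obtain ⟨q₁, hq₁, hf, hq⟩ := hq
    have hs := sat_of_meets (hτ hz) hq hm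
    rw [List.append_assoc]
    exact ih (fun β hβ => hz β (by simp [hβ])) hq₁ (Or.inr ⟨hf, α, z', rfl, hs⟩)

lemma exists_mem_trackAlong (hac : G.bat.Acyclic) (hw : G.bat.Sat w) {z z' : Trace S}
    (hz : ∀ α ∈ z, α ∈ G.actions) (hs : Φ.tnf.Sat w [] (z ++ z')) :
    ∃ q ∈ G.trackAlong Φ (G.typeOf Φ w) z, Meets w q z z' ∧ (z' ≠ [] → .eventuallyTail ∈ q.1) := by
  have hτ : ∀ {y : Trace S}, (∀ α ∈ y, α ∈ G.actions) → ∀ φ ∈ Φ.atoms,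
      φ.TrueAt w y → (φ, G.effectsAlong (G.typeOf Φ w) y) ∈ G.typeOf Φ w :=
    fun hy φ hφ h => (mem_typeOf_iff hac hw hy (.temporal hφ)).2 h
  have hτn : ∀ {y : Trace S}, (∀ α ∈ y, α ∈ G.actions) → ∀ φ ∈ Φ.atoms,
      ¬ φ.TrueAt w y → (φ.neg, G.effectsAlong (G.typeOf Φ w) y) ∈ G.typeOf Φ w :=
    fun hy φ hφ h => (mem_typeOf_iff hac hw hy (.neg (.temporal hφ))).2 h
  induction z using List.reverseRecOn generalizing z' with
  | nil =>
    exact exists_meets Φ.tracked_tnf (hτ (y := []) (by simp)) (hτn (y := []) (by simp))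
      (Or.inr (Or.inl rfl)) (Or.inr (Or.inr (Or.inr rfl))) hs
  | append_singleton z α ih =>
    rw [List.append_assoc] at hs
    obtain ⟨q₁, hq₁, hm, hev⟩ := ih (fun β hβ => hz β (by simp [hβ])) hs
    have hev := hev (by simp)
    rcases hm with ⟨-, -, h⟩ | ⟨hf, β, z'', h, hsat⟩
    · simp at h
    · cases h
      obtain ⟨q, hq, h⟩ := exists_meets
        (LTLf.tracked_bigAnd (trackAlong_subset_closure _ _ q₁ hq₁)) (hτ hz) (hτn hz)
        (TForm.mem_propAtoms_xnf_bigAnd.2 ⟨_, hev, Or.inl rfl⟩)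
        (TForm.mem_propAtoms_xnf_bigAnd.2 ⟨_, hev, Or.inr (Or.inr rfl)⟩) hsat
      refine ⟨q, ?_, h⟩
      rw [trackAlong_append]
      exact ⟨q₁, hq₁, hf, hq⟩

/-- The arena accepts after `z` iff `z`, taken as a complete trace, satisfies the temporal
formula. -/
lemma accepting_trackAlong_iff (hac : G.bat.Acyclic) (hw : G.bat.Sat w) {z : Trace S}
    (hz : ∀ α ∈ z, α ∈ G.actions) :
    ((∅ : Finset (TForm S)), true) ∈ G.trackAlong Φ (G.typeOf Φ w) z ↔ Φ.Sat w [] z := by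
  rw [← LTLf.sat_tnf]
  constructor
  · intro h
    simpa using sat_of_mem_trackAlong hac hw hz h (z' := []) (Or.inl ⟨rfl, rfl, rfl⟩)
  · intro h
    obtain ⟨⟨χ, t⟩, hq, hm, -⟩ := exists_mem_trackAlong hac hw hz (z' := []) (by simpa using h)
    rcases hm with ⟨rfl, rfl, -⟩ | ⟨-, α, z'', h, -⟩
    · exact hq
    · simp at h

end GologProgram

/-! ### Characteristic graphs -/

namespace Prog

lemma self_mem_sub (δ : Prog S) : δ ∈ δ.sub := Relation.ReflTransGen.refl

lemma mem_sub_of_edge {δ ρ ρ' : Prog S} {α : GAct S} {ψ : Fml S 0} (h : ρ ∈ δ.sub)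
    (he : Edge ρ α ψ ρ') : ρ' ∈ δ.sub :=
  Relation.ReflTransGen.tail h ⟨α, ψ, he⟩

lemma sub_subset {δ : Prog S} {T : Set (Prog S)} (h : δ ∈ T)
    (hT : ∀ ρ ∈ T, ∀ α ψ ρ', Edge ρ α ψ ρ' → ρ' ∈ T) : δ.sub ⊆ T := by
  intro ρ hρ
  induction (show Relation.ReflTransGen _ δ ρ from hρ) with
  | refl => exact h
  | tail h₁ he ih =>
    obtain ⟨α, ψ, he⟩ := he
    exact hT _ (ih h₁) α ψ _ he

lemma sub_finite (δ : Prog S) : δ.sub.Finite := by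
  induction δ with
  | act α =>
    refine ((Set.finite_singleton nil).insert (act α)).subset (sub_subset (Or.inl rfl) ?_)
    rintro ρ (rfl | rfl) β ψ ρ' he <;> cases he
    exact Or.inr rfl
  | test φ =>
    refine (Set.finite_singleton (test φ)).subset (sub_subset rfl ?_)
    rintro ρ rfl β ψ ρ' he
    cases he
  | seq δ₁ δ₂ ih₁ ih₂ =>
    refine ((ih₁.image (seq · δ₂)).union ih₂).subset
      (sub_subset (Or.inl ⟨δ₁, self_mem_sub δ₁, rfl⟩) ?_)
    rintro ρ (⟨ρ₁, h₁, rfl⟩ | h₂) β ψ ρ' he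
    · cases he with
      | seq_left he => exact Or.inl ⟨_, mem_sub_of_edge h₁ he, rfl⟩
      | seq_right he => exact Or.inr (mem_sub_of_edge (self_mem_sub δ₂) he)
    · exact Or.inr (mem_sub_of_edge h₂ he)
  | choice δ₁ δ₂ ih₁ ih₂ =>
    refine ((ih₁.union ih₂).insert (choice δ₁ δ₂)).subset (sub_subset (Or.inl rfl) ?_)
    rintro ρ (rfl | h₁ | h₂) β ψ ρ' he
    · cases he with
      | choice_left he => exact Or.inr (Or.inl (mem_sub_of_edge (self_mem_sub δ₁) he))
      | choice_right he => exact Or.inr (Or.inr (mem_sub_of_edge (self_mem_sub δ₂) he))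
    · exact Or.inr (Or.inl (mem_sub_of_edge h₁ he))
    · exact Or.inr (Or.inr (mem_sub_of_edge h₂ he))
  | par δ₁ δ₂ ih₁ ih₂ =>
    refine (ih₁.image2 par ih₂).subset
      (sub_subset ⟨δ₁, self_mem_sub δ₁, δ₂, self_mem_sub δ₂, rfl⟩ ?_)
    rintro ρ ⟨ρ₁, h₁, ρ₂, h₂, rfl⟩ β ψ ρ' he
    cases he with
    | par_left he => exact ⟨_, mem_sub_of_edge h₁ he, _, h₂, rfl⟩
    | par_right he => exact ⟨_, h₁, _, mem_sub_of_edge h₂ he, rfl⟩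
  | star δ ih =>
    refine ((ih.image (seq · (star δ))).insert (star δ)).subset (sub_subset (Or.inl rfl) ?_)
    rintro ρ (rfl | ⟨ρ₁, h₁, rfl⟩) β ψ ρ' he
    · cases he with
      | star he => exact Or.inr ⟨_, mem_sub_of_edge (self_mem_sub δ) he, rfl⟩
    · cases he with
      | seq_left he => exact Or.inr ⟨_, mem_sub_of_edge h₁ he, rfl⟩
      | seq_right he =>
        cases he with
        | star he => exact Or.inr ⟨_, mem_sub_of_edge (self_mem_sub δ) he, rfl⟩

lemma guards_finite (ρ : Prog S) : {ψ | ∃ α ρ', Edge ρ α ψ ρ'}.Finite := by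
  induction ρ with
  | act α =>
    refine (Set.finite_singleton Fml.top).subset ?_
    rintro ψ ⟨β, ρ', he⟩
    cases he
    rfl
  | test φ =>
    refine Set.finite_empty.subset ?_
    rintro ψ ⟨β, ρ', he⟩
    cases he
  | seq δ₁ δ₂ ih₁ ih₂ =>
    refine (ih₁.union (ih₂.image (Fml.and (termCond δ₁)))).subset ?_
    rintro ψ ⟨β, ρ', he⟩
    cases he with
    | seq_left he => exact Or.inl ⟨_, _, he⟩
    | seq_right he => exact Or.inr ⟨_, ⟨_, _, he⟩, rfl⟩
  | choice δ₁ δ₂ ih₁ ih₂ =>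
    refine (ih₁.union ih₂).subset ?_
    rintro ψ ⟨β, ρ', he⟩
    cases he with
    | choice_left he => exact Or.inl ⟨_, _, he⟩
    | choice_right he => exact Or.inr ⟨_, _, he⟩
  | par δ₁ δ₂ ih₁ ih₂ =>
    refine (ih₁.union ih₂).subset ?_
    rintro ψ ⟨β, ρ', he⟩
    cases he with
    | par_left he => exact Or.inl ⟨_, _, he⟩
    | par_right he => exact Or.inr ⟨_, _, he⟩
  | star δ ih =>
    refine ih.subset ?_
    rintro ψ ⟨β, ρ', he⟩
    cases he with
    | star he => exact ⟨_, _, he⟩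

lemma actions_finite (δ : Prog S) : δ.actions.Finite := by
  induction δ with
  | act α => exact Set.finite_singleton α
  | test φ => exact Set.finite_empty
  | seq δ₁ δ₂ ih₁ ih₂ | choice δ₁ δ₂ ih₁ ih₂ | par δ₁ δ₂ ih₁ ih₂ => exact ih₁.union ih₂
  | star δ ih => exact ih

lemma Edge.mem_actions {ρ ρ' : Prog S} {α : GAct S} {ψ : Fml S 0} (he : Edge ρ α ψ ρ') :
    α ∈ ρ.actions ∧ ρ'.actions ⊆ ρ.actions := by
  induction he with
  | act α => exact ⟨rfl, Set.empty_subset _⟩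
  | seq_left _ ih | par_left _ ih => exact ⟨Or.inl ih.1, Set.union_subset_union_left _ ih.2⟩
  | seq_right _ ih | choice_right _ ih => exact ⟨Or.inr ih.1, fun _ h => Or.inr (ih.2 h)⟩
  | choice_left _ ih => exact ⟨Or.inl ih.1, fun _ h => Or.inl (ih.2 h)⟩
  | par_right _ ih => exact ⟨Or.inr ih.1, Set.union_subset_union_right _ ih.2⟩
  | star _ ih => exact ⟨ih.1, Set.union_subset ih.2 subset_rfl⟩

lemma actions_subset_of_mem_sub {δ ρ : Prog S} (h : ρ ∈ δ.sub) : ρ.actions ⊆ δ.actions :=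
  sub_subset (T := {ρ | ρ.actions ⊆ δ.actions}) (subset_rfl : δ.actions ⊆ δ.actions)
    (fun _ hρ _ _ _ he => he.mem_actions.2.trans hρ) h

/-- Final configurations are those whose termination condition holds. -/
lemma final_iff {w : World S} {z : Trace S} {ρ : Prog S} :
    Final w z ρ ↔ ρ.termCond.TrueAt w z := by
  induction ρ with
  | act α => exact ⟨fun h => (by cases h), fun h => absurd trivial h⟩
  | test φ => exact ⟨fun h => (by cases h; assumption), .test⟩
  | seq δ₁ δ₂ ih₁ ih₂ =>
    exact ⟨fun h => (by cases h with | seq h₁ h₂ => exact ⟨ih₁.1 h₁, ih₂.1 h₂⟩),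
      fun h => .seq (ih₁.2 h.1) (ih₂.2 h.2)⟩
  | choice δ₁ δ₂ ih₁ ih₂ =>
    refine Iff.trans ?_ (Fml.sat_or _ _ _).symm
    refine ⟨fun h => ?_, fun h => h.elim (fun h => .choice_left (ih₁.2 h))
      fun h => .choice_right (ih₂.2 h)⟩
    cases h with
    | choice_left h => exact Or.inl (ih₁.1 h)
    | choice_right h => exact Or.inr (ih₂.1 h)
  | par δ₁ δ₂ ih₁ ih₂ =>
    exact ⟨fun h => (by cases h with | par h₁ h₂ => exact ⟨ih₁.1 h₁, ih₂.1 h₂⟩),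
      fun h => .par (ih₁.2 h.1) (ih₂.2 h.2)⟩
  | star δ ih => exact ⟨fun _ => trivial, fun _ => .star⟩

/-- The transition relation follows the edges of the characteristic graph whose guards hold. -/
lemma trans_iff {w : World S} {z z' : Trace S} {ρ ρ' : Prog S} :
    Trans w (z, ρ) (z', ρ') ↔ ∃ α ψ, z' = z ++ [α] ∧ Edge ρ α ψ ρ' ∧ ψ.TrueAt w z := by
  constructor
  · intro h
    generalize hc : (z, ρ) = c at h
    generalize hc' : (z', ρ') = c' at h
    induction h generalizing z ρ z' ρ' with
    | act z α =>
      cases hc; cases hc'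
      exact ⟨α, _, rfl, .act α, trivial⟩
    | seq_left _ ih =>
      cases hc; cases hc'
      obtain ⟨α, ψ, h, he, ht⟩ := ih rfl rfl
      exact ⟨α, ψ, h, .seq_left he, ht⟩
    | seq_right hf _ ih =>
      cases hc; cases hc'
      obtain ⟨α, ψ, h, he, ht⟩ := ih rfl rfl
      exact ⟨α, _, h, .seq_right he, final_iff.1 hf, ht⟩
    | choice_left _ ih =>
      cases hc; cases hc'
      obtain ⟨α, ψ, h, he, ht⟩ := ih rfl rfl
      exact ⟨α, ψ, h, .choice_left he, ht⟩
    | choice_right _ ih =>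
      cases hc; cases hc'
      obtain ⟨α, ψ, h, he, ht⟩ := ih rfl rfl
      exact ⟨α, ψ, h, .choice_right he, ht⟩
    | par_left _ ih =>
      cases hc; cases hc'
      obtain ⟨α, ψ, h, he, ht⟩ := ih rfl rfl
      exact ⟨α, ψ, h, .par_left he, ht⟩
    | par_right _ ih =>
      cases hc; cases hc'
      obtain ⟨α, ψ, h, he, ht⟩ := ih rfl rfl
      exact ⟨α, ψ, h, .par_right he, ht⟩
    | star _ ih =>
      cases hc; cases hc'
      obtain ⟨α, ψ, h, he, ht⟩ := ih rfl rfl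
      exact ⟨α, ψ, h, .star he, ht⟩
  · rintro ⟨α, ψ, rfl, he, ht⟩
    induction he with
    | act α => exact .act z α
    | seq_left _ ih => exact .seq_left (ih ht)
    | seq_right _ ih => exact .seq_right (final_iff.2 ht.1) (ih ht.2)
    | choice_left _ ih => exact .choice_left (ih ht)
    | choice_right _ ih => exact .choice_right (ih ht)
    | par_left _ ih => exact .par_left (ih ht)
    | par_right _ ih => exact .par_right (ih ht)
    | star _ ih => exact .star (ih ht)

end Prog

/-! ### Finiteness of the game arena -/

lemma finite_finsets_subset {β : Type*} {R : Set β} (hR : R.Finite) :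
    {E : Finset β | (E : Set β) ⊆ R}.Finite :=
  Set.Finite.of_injOn (f := fun E : Finset β => (E : Set β)) (t := {A | A ⊆ R})
    (fun _ hE => hE) (fun _ _ _ _ h => Finset.coe_injective h) hR.finite_subsets

lemma LTLf.atoms_finite (Φ : LTLf S) : Φ.atoms.Finite := by
  induction Φ with
  | atom φ => exact Set.finite_singleton φ
  | not Φ ih | next Φ ih => exact ih
  | and Φ₁ Φ₂ ih₁ ih₂ | untl Φ₁ Φ₂ ih₁ ih₂ => exact ih₁.union ih₂

namespace GologProgram

variable (G : GologProgram S) (Φ : LTLf S)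

lemma effDescs_finite (sgn : Bool) (F : S.Flu) : (G.effDescs sgn F).Finite := by
  refine (G.prog.actions_finite.biUnion fun α _ =>
    ((G.bat.grounded sgn F α).finite_toSet.image Prod.fst)).subset ?_
  rintro ε ⟨α, hα, κ, h⟩
  exact Set.mem_biUnion hα ⟨(ε, κ), h, rfl⟩

lemma effectsBelow_finite (j : ℕ) : (G.effectsBelow j).Finite := by
  classical
  induction j with
  | zero => exact Set.finite_empty
  | succ j ih =>
    have hE := finite_finsets_subset ih
    have hX : ∀ F, {X : Finset (Fml S (S.fluArity F) × Finset (Effect S)) |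
        (X : Set _) ⊆ G.effDescs false F ×ˢ
          {E : Finset (Effect S) | (E : Set (Effect S)) ⊆ G.effectsBelow j}}.Finite :=
      fun F => finite_finsets_subset ((G.effDescs_finite false F).prod hE)
    refine (ih.union ?_).union ?_
    · refine (Set.finite_iUnion fun F => (G.effDescs_finite false F).image2
        (fun ε E => (⟨F, false, regressDesc E {ε}⟩ : Effect S)) hE).subset ?_
      rintro _ ⟨F, ε, E, -, hε, hE, rfl⟩
      exact Set.mem_iUnion.2 ⟨F, ε, hε, E, hE, rfl⟩
    · let mk : (F : S.Flu) → Fml S (S.fluArity F) → Finset (Effect S) ×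
          Finset (Fml S (S.fluArity F) × Finset (Effect S)) → Effect S := fun F φ q =>
        ⟨F, true, regressDesc q.1 {φ} ∪
          q.2.image (fun p => Fml.neg (descFml (regressDesc p.2 {p.1})))⟩
      have hfin : (⋃ F, Set.image2 (mk F) (G.effDescs true F) _).Finite :=
        Set.finite_iUnion fun F => (G.effDescs_finite true F).image2 (mk F) (hE.prod (hX F))
      refine hfin.subset ?_
      rintro _ ⟨F, φ, E, X, -, hφ, hE, hX, rfl⟩
      exact Set.mem_iUnion.2 ⟨F, φ, hφ, (E, X), ⟨hE, fun p hp => hX p hp⟩, rfl⟩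

lemma relevantEffects_finite : G.relevantEffects.Finite := G.effectsBelow_finite _

/-- The generators of the context, before closing under negation. -/
inductive ContextBase : Fml S 0 → Prop
  | initial {φ : Fml S 0} : φ ∈ G.bat.initial → ContextBase φ
  | contextCond {sgn : Bool} {F : S.Flu} {α : GAct S} {ε : Fml S (S.fluArity F)} {κ : Fml S 0} :
      α ∈ G.actions → (ε, κ) ∈ G.bat.grounded sgn F α → ContextBase κ
  | guard {ρ ρ' : Prog S} {α : GAct S} {ψ : Fml S 0} :
      ρ ∈ G.prog.sub → Prog.Edge ρ α ψ ρ' → ContextBase ψ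
  | termCond {ρ : Prog S} : ρ ∈ G.prog.sub → ContextBase ρ.termCond
  | temporal {φ : Fml S 0} : φ ∈ Φ.atoms → ContextBase φ

lemma contextBase_finite : {φ | G.ContextBase Φ φ}.Finite := by
  refine ((((G.bat.initial.finite_toSet.union
    (Set.finite_iUnion fun q : Bool × S.Flu => G.prog.actions_finite.biUnion fun α _ =>
      ((G.bat.grounded q.1 q.2 α).finite_toSet.image Prod.snd))).union
    (G.prog.sub_finite.biUnion fun ρ _ => ρ.guards_finite)).union
    (G.prog.sub_finite.image Prog.termCond)).union Φ.atoms_finite).subset ?_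
  intro φ hφ
  cases hφ with
  | initial h => exact Or.inl (Or.inl (Or.inl (Or.inl h)))
  | @contextCond sgn F α ε _ hα h =>
    exact Or.inl (Or.inl (Or.inl (Or.inr
      (Set.mem_iUnion.2 ⟨(sgn, F), Set.mem_biUnion hα ⟨(ε, φ), h, rfl⟩⟩))))
  | guard h he => exact Or.inl (Or.inl (Or.inr (Set.mem_biUnion h ⟨_, _, he⟩)))
  | termCond h => exact Or.inl (Or.inr ⟨_, h, rfl⟩)
  | temporal h => exact Or.inr h

variable {G Φ}

lemma ContextBase.context {φ : Fml S 0} (h : G.ContextBase Φ φ) : G.Context Φ φ := by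
  cases h with
  | initial h => exact .initial h
  | contextCond hα h => exact .contextCond hα h
  | guard h he => exact .guard h he
  | termCond h => exact .termCond h
  | temporal h => exact .temporal h

/-- Worlds that agree on the regressed generators of the context agree on the regressed context. -/
lemma Context.trueAt_regress_congr {w w' : World S} {E : Finset (Effect S)}
    (h : ∀ φ, G.ContextBase Φ φ → ((regress E φ).TrueAt w [] ↔ (regress E φ).TrueAt w' []))
    {φ : Fml S 0} (hφ : G.Context Φ φ) :
    (regress E φ).TrueAt w [] ↔ (regress E φ).TrueAt w' [] := by
  induction hφ with
  | initial h' => exact h _ (.initial h')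
  | contextCond hα h' => exact h _ (.contextCond hα h')
  | guard h' he => exact h _ (.guard h' he)
  | termCond h' => exact h _ (.termCond h')
  | temporal h' => exact h _ (.temporal h')
  | neg _ ih => exact not_congr ih

variable (G Φ)

/-- A type is determined by its elements whose formula is a generator of the context, and these form
a finite set. -/
lemma types_finite : {τ | G.IsType Φ τ}.Finite := by
  let B : TypeSet S := {φ | G.ContextBase Φ φ} ×ˢ
    {E : Finset (Effect S) | (E : Set (Effect S)) ⊆ G.relevantEffects}
  have hB : B.Finite :=
    (G.contextBase_finite Φ).prod (finite_finsets_subset G.relevantEffects_finite)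
  refine Set.Finite.of_injOn (f := fun τ => τ ∩ B) (t := {A | A ⊆ B})
    (fun τ _ => Set.inter_subset_right) ?_ hB.finite_subsets
  intro τ hτ τ' hτ' h
  obtain ⟨w, rfl⟩ := IsType.exists_eq_typeOf hτ
  obtain ⟨w', rfl⟩ := IsType.exists_eq_typeOf hτ'
  have hbase : ∀ E : Finset (Effect S), (E : Set (Effect S)) ⊆ G.relevantEffects → ∀ φ,
      G.ContextBase Φ φ → ((regress E φ).TrueAt w [] ↔ (regress E φ).TrueAt w' []) := by
    intro E hE φ hφ
    have hm : (φ, E) ∈ G.typeElements Φ := ⟨hφ.context, hE⟩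
    have hmB : (φ, E) ∈ B := ⟨hφ, hE⟩
    have := Set.ext_iff.1 h (φ, E)
    simp only [Set.mem_inter_iff, mem_typeOf, hm, hmB, true_and, and_true] at this
    exact this
  ext ⟨φ, E⟩
  rw [mem_typeOf, mem_typeOf]
  exact and_congr_right fun hm => Context.trueAt_regress_congr (hbase E hm.2) hm.1

lemma arenaStates_finite : (G.arenaStates Φ).Finite := by
  have hA : {A : Set (Finset (TForm S) × Bool) |
      A ⊆ {χ : Finset (TForm S) | (χ : Set (TForm S)) ⊆ Φ.tnf.closure} ×ˢ Set.univ}.Finite :=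
    ((finite_finsets_subset Φ.tnf.closure_finite).prod Set.finite_univ).finite_subsets
  refine (((G.types_finite Φ).prod ((finite_finsets_subset G.relevantEffects_finite).prod
    (hA.prod G.prog.sub_finite))).image fun p =>
      (⟨p.1, p.2.1, p.2.2.1, p.2.2.2⟩ : ArenaState S)).subset ?_
  rintro ⟨τ, E, A, ρ⟩ ⟨hτ, hρ, hE, hA⟩
  exact ⟨(τ, E, A, ρ), ⟨hτ, hE, fun q hq => ⟨hA q hq, trivial⟩, hρ⟩, rfl⟩

end GologProgram

/-! ### Arena states of configurations -/

namespace GologProgram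

variable {G : GologProgram S} {Φ : LTLf S} {w : World S}

/-- The arena state of the configuration `⟨z, ρ⟩` in the world `w`. -/
noncomputable def stateOf (G : GologProgram S) (Φ : LTLf S) (w : World S) (c : Trace S × Prog S) :
    ArenaState S :=
  ⟨G.typeOf Φ w, G.effectsAlong (G.typeOf Φ w) c.1, G.trackAlong Φ (G.typeOf Φ w) c.1, c.2⟩

/-- The configurations made of program actions and nodes of the characteristic graph. -/
def IsConfig (G : GologProgram S) (c : Trace S × Prog S) : Prop :=
  (∀ α ∈ c.1, α ∈ G.actions) ∧ c.2 ∈ G.prog.sub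

lemma isConfig_initial : G.IsConfig ([], G.prog) := ⟨by simp, Prog.self_mem_sub _⟩

lemma IsConfig.of_trans {z z' : Trace S} {ρ ρ' : Prog S} (h : G.IsConfig (z, ρ))
    (ht : Prog.Trans w (z, ρ) (z', ρ')) : G.IsConfig (z', ρ') := by
  obtain ⟨α, ψ, rfl, he, -⟩ := Prog.trans_iff.1 ht
  refine ⟨fun β hβ => ?_, Prog.mem_sub_of_edge h.2 he⟩
  rcases List.mem_append.1 hβ with hβ | hβ
  · exact h.1 β hβ
  · rw [List.mem_singleton.1 hβ]
    exact Prog.actions_subset_of_mem_sub h.2 he.mem_actions.1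

lemma stateOf_mem_arenaStates (hac : G.bat.Acyclic) (hw : G.bat.Sat w) {c : Trace S × Prog S}
    (hc : G.IsConfig c) : G.stateOf Φ w c ∈ G.arenaStates Φ :=
  ⟨isType_typeOf hw.1, hc.2, effectsAlong_subset hac _ hc.1, trackAlong_subset_closure _ _⟩

lemma stateOf_initial_mem (hac : G.bat.Acyclic) (hw : G.bat.Sat w) :
    G.stateOf Φ w ([], G.prog) ∈ G.arenaInitial Φ :=
  ⟨stateOf_mem_arenaStates hac hw isConfig_initial, ⟨w, hw, rfl⟩, rfl, rfl, rfl⟩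

lemma exists_eq_stateOf_of_mem_arenaInitial {s : ArenaState S} (hs : s ∈ G.arenaInitial Φ) :
    ∃ w, G.bat.Sat w ∧ s = G.stateOf Φ w ([], G.prog) := by
  obtain ⟨τ, E, A, ρ⟩ := s
  obtain ⟨-, ⟨w, hw, rfl⟩, rfl, rfl, hA⟩ := hs
  dsimp only at hA
  subst hA
  exact ⟨w, hw, rfl⟩

/-- The arena simulates the configurations of each world step by step, and conversely. -/
lemma arenaTrans_stateOf_iff (hac : G.bat.Acyclic) (hw : G.bat.Sat w) {c : Trace S × Prog S}
    (hc : G.IsConfig c) {α : GAct S} {s : ArenaState S} :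
    G.ArenaTrans Φ (G.stateOf Φ w c) α s ↔
      ∃ ρ', s = G.stateOf Φ w (c.1 ++ [α], ρ') ∧ Prog.Trans w c (c.1 ++ [α], ρ') := by
  obtain ⟨z, ρ⟩ := c
  constructor
  · obtain ⟨τ, E, A, ρ'⟩ := s
    rintro ⟨-, -, hτ, ⟨ψ, he, hψ⟩, hE, hA⟩
    have ht := (mem_typeOf_iff hac hw hc.1 (.guard hc.2 he)).1 hψ
    refine ⟨ρ', ?_, Prog.trans_iff.2 ⟨α, ψ, rfl, he, ht⟩⟩
    dsimp only at hτ hE hA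
    subst hτ hE hA
    simp only [stateOf, effectsAlong_append, trackAlong_append]
    rfl
  · rintro ⟨ρ', rfl, ht⟩
    have hc' := hc.of_trans ht
    obtain ⟨β, ψ, hz, he, hψ⟩ := Prog.trans_iff.1 ht
    have hβ : α = β := by simpa using hz
    subst hβ
    refine ⟨stateOf_mem_arenaStates hac hw hc, stateOf_mem_arenaStates hac hw hc', rfl,
      ⟨ψ, he, (mem_typeOf_iff hac hw hc.1 (.guard hc.2 he)).2 hψ⟩, ?_, ?_⟩
    · exact effectsAlong_append ..
    · exact trackAlong_append ..

lemma exists_arenaTrans_stateOf_iff (hac : G.bat.Acyclic) (hw : G.bat.Sat w)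
    {c : Trace S × Prog S} (hc : G.IsConfig c) {α : GAct S} :
    (∃ s, G.ArenaTrans Φ (G.stateOf Φ w c) α s) ↔
      ∃ ρ' ∈ G.prog.sub, Prog.Trans w c (c.1 ++ [α], ρ') := by
  simp only [arenaTrans_stateOf_iff hac hw hc]
  constructor
  · rintro ⟨_, ρ', rfl, ht⟩
    exact ⟨ρ', (hc.of_trans ht).2, ht⟩
  · rintro ⟨ρ', -, ht⟩
    exact ⟨_, ρ', rfl, ht⟩

lemma isFinal_stateOf_iff (hac : G.bat.Acyclic) (hw : G.bat.Sat w) {c : Trace S × Prog S}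
    (hc : G.IsConfig c) : (G.stateOf Φ w c).IsFinal ↔ Prog.Final w c.1 c.2 := by
  rw [Prog.final_iff]
  exact mem_typeOf_iff hac hw hc.1 (.termCond hc.2)

lemma isAccepting_stateOf_iff (hac : G.bat.Acyclic) (hw : G.bat.Sat w) {c : Trace S × Prog S}
    (hc : G.IsConfig c) : (G.stateOf Φ w c).IsAccepting ↔ Φ.Sat w [] c.1 :=
  accepting_trackAlong_iff hac hw hc.1

end GologProgram

/-! ### From strategies to policies -/

namespace Strategy

variable {G : GologProgram S} {Φ : LTLf S} {AE : Set (GAct S)}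

open Classical in
/-- The policy that plays a strategy of the arena in every world of the theory. -/
noncomputable def toPolicy (hac : G.bat.Acyclic) (σ : Strategy G Φ AE) : Policy G AE where
  toFun w z ρ :=
    if G.bat.Sat w ∧ G.IsConfig (z, ρ) then σ.toFun (G.stateOf Φ w (z, ρ)) else none
  dom w z ρ U h := by
    split_ifs at h with hc
    exact ⟨hc.2.2, (σ.valid _ _ h).1⟩
  initial w hw := by
    rw [if_pos ⟨hw, GologProgram.isConfig_initial⟩]
    exact σ.initial _ (GologProgram.stateOf_initial_mem hac hw)
  applicable w z ρ U h α hα := by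
    split_ifs at h with hc
    exact (GologProgram.exists_arenaTrans_stateOf_iff hac hc.1 hc.2).1 ((σ.valid _ _ h).2.1 α hα)
  succ w z ρ U h α hα ρ' ht := by
    split_ifs at h with hc
    rw [if_pos ⟨hc.1, hc.2.of_trans ht⟩]
    exact σ.succ _ U h α hα _ ((GologProgram.arenaTrans_stateOf_iff hac hc.1 hc.2).2 ⟨ρ', rfl, ht⟩)
  environment w z ρ U h α hα ht := by
    split_ifs at h with hc
    obtain ⟨s, hs⟩ := (GologProgram.exists_arenaTrans_stateOf_iff hac hc.1 hc.2).2 ht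
    exact (σ.valid _ _ h).2.2.1 α hα s hs
  nonblocking w z ρ h := by
    split_ifs at h with hc
    exact (GologProgram.isFinal_stateOf_iff hac hc.1 hc.2).1 ((σ.valid _ _ h).2.2.2 rfl)

lemma toPolicy_eq_some {hac : G.bat.Acyclic} {σ : Strategy G Φ AE} {w : World S}
    {c : Trace S × Prog S} {U : Set (GAct S)} :
    (σ.toPolicy hac).toFun w c.1 c.2 = some U ↔
      (G.bat.Sat w ∧ G.IsConfig c) ∧ σ.toFun (G.stateOf Φ w c) = some U := by
  simp only [toPolicy]
  split_ifs with h
  · exact ⟨fun hU => ⟨h, hU⟩, fun hU => hU.2⟩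
  · exact ⟨fun hU => (by cases hU), fun hU => absurd hU.1 h⟩

lemma step_of_toPolicy_step {hac : G.bat.Acyclic} {σ : Strategy G Φ AE} {w : World S}
    {c c' : Trace S × Prog S} (h : (σ.toPolicy hac).Step w c c') :
    σ.Step (G.stateOf Φ w c) (G.stateOf Φ w c') := by
  obtain ⟨U, hU, α, hα, hz, ht⟩ := h
  obtain ⟨hc, hU⟩ := toPolicy_eq_some.1 hU
  obtain ⟨z', ρ'⟩ := c'
  obtain rfl : z' = c.1 ++ [α] := hz
  exact ⟨U, hU, α, hα, (GologProgram.arenaTrans_stateOf_iff hac hc.1 hc.2).2 ⟨ρ', rfl, ht⟩⟩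

lemma toPolicy_stopsAt_iff {hac : G.bat.Acyclic} {σ : Strategy G Φ AE} {w : World S}
    (hw : G.bat.Sat w) {c : Trace S × Prog S} (hc : G.IsConfig c) :
    (σ.toPolicy hac).StopsAt w c ↔ σ.StopsAt (G.stateOf Φ w c) := by
  simp only [Policy.StopsAt, StopsAt, toPolicy_eq_some, hw, hc, true_and,
    GologProgram.isFinal_stateOf_iff hac hw hc]

lemma toPolicy_terminating (hac : G.bat.Acyclic) {σ : Strategy G Φ AE} (hσ : σ.Terminating) :
    (σ.toPolicy hac).Terminating := by
  intro w c _ hstep i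
  obtain ⟨j, hj, hs⟩ := hσ (fun k => G.stateOf Φ w (c k))
    (fun k => step_of_toPolicy_step (hstep k)) i
  obtain ⟨U, hU, -⟩ := hstep j
  obtain ⟨hw, hc⟩ := (toPolicy_eq_some.1 hU).1
  exact ⟨j, hj, (toPolicy_stopsAt_iff hw hc).2 hs⟩

lemma toPolicy_satisfies (hac : G.bat.Acyclic) {σ : Strategy G Φ AE} (hσ : σ.Winning) :
    (σ.toPolicy hac).Satisfies Φ := by
  rintro w hw z ⟨ρ, h0, hstep, hstops⟩
  obtain ⟨U, hU, -⟩ := id hstops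
  have hc := (toPolicy_eq_some.1 hU).1.2
  have hplay : σ.IsPlay z.length fun i => G.stateOf Φ w (z.take i, ρ i) := by
    refine ⟨?_, fun i => step_of_toPolicy_step (hstep i i.2), ?_⟩
    · simpa [h0] using GologProgram.stateOf_initial_mem hac hw
    · simpa using (toPolicy_stopsAt_iff hw hc).1 hstops
  have hacc := hσ _ _ hplay
  have := (GologProgram.isAccepting_stateOf_iff (Φ := Φ) hac hw hc).1 (by simpa using hacc)
  exact this

end Strategy

/-! ### Memoryless strategies from attractors -/

namespace GologProgram

variable (G : GologProgram S) (Φ : LTLf S) (AE : Set (GAct S))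

/-- The successors of `s` under the actions in `U`. -/
def successors (s : ArenaState S) (U : Set (GAct S)) : Set (ArenaState S) :=
  {s' | ∃ α ∈ U, G.ArenaTrans Φ s α s'}

/-- `U` is a valid choice in `s` that does not permit to stop unless `s` is accepting. -/
def IsSafe (s : ArenaState S) (U : Set (GAct S)) : Prop :=
  s ∈ G.arenaStates Φ ∧ G.ValidIn Φ AE s U ∧ (U ⊆ AE → s.IsFinal → s.IsAccepting)

/-- The states from which safe choices enforce, in less than `n` steps, a state where stopping is
possible and all successors lie in `X`. -/
def attractor (X : Set (ArenaState S)) : ℕ → Set (ArenaState S)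
  | 0 => ∅
  | n + 1 => {s | ∃ U, G.IsSafe Φ AE s U ∧
      ((U ⊆ AE ∧ s.IsFinal ∧ G.successors Φ s U ⊆ X) ∨ G.successors Φ s U ⊆ attractor X n)}

variable {G Φ AE} {X : Set (ArenaState S)}

lemma attractor_mono {m n : ℕ} (h : m ≤ n) : G.attractor Φ AE X m ⊆ G.attractor Φ AE X n := by
  induction n generalizing m with
  | zero =>
    obtain rfl : m = 0 := by omega
    exact subset_rfl
  | succ n ih =>
    cases m with
    | zero => exact Set.empty_subset _
    | succ m =>
      rintro s ⟨U, hU, h'⟩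
      exact ⟨U, hU, h'.imp_right fun h' => h'.trans (ih (by omega))⟩

/-- Since the arena is finite, finitely many attractor levels cover the successors of a state. -/
lemma exists_successors_subset_attractor {s : ArenaState S} {U : Set (GAct S)}
    (h : ∀ s' ∈ G.successors Φ s U, ∃ n, s' ∈ G.attractor Φ AE X n) :
    ∃ n, G.successors Φ s U ⊆ G.attractor Φ AE X n := by
  have hfin : (G.successors Φ s U).Finite := (G.arenaStates_finite Φ).subset (by
    rintro s' ⟨α, -, ht⟩
    exact ht.2.1)
  choose! n hn using h
  refine ⟨hfin.toFinset.sup n, fun s' hs' => attractor_mono ?_ (hn s' hs')⟩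
  exact Finset.le_sup (f := n) (hfin.mem_toFinset.2 hs')

open Classical in
/-- If every state in `X` belongs to an attractor of `X`, then there is a memoryless strategy: choose
the action set that witnesses membership in the least possible attractor level. While it cannot stop,
the level decreases. -/
lemma exists_strategy_of_subset_attractor (hX : ∀ s ∈ X, ∃ n, s ∈ G.attractor Φ AE X n)
    (hinit : G.arenaInitial Φ ⊆ X) : ∃ σ : Strategy G Φ AE, σ.Terminating ∧ σ.Winning := by
  let rank : ArenaState S → ℕ := fun s => sInf {n | s ∈ G.attractor Φ AE X n}
  have hrank : ∀ {s n}, s ∈ G.attractor Φ AE X n → rank s ≤ n := fun h => Nat.sInf_le h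
  have hchoice : ∀ s, (∃ n, s ∈ G.attractor Φ AE X n) → ∃ U, G.IsSafe Φ AE s U ∧
      ((U ⊆ AE ∧ s.IsFinal ∧ G.successors Φ s U ⊆ X) ∨
        ∃ m < rank s, G.successors Φ s U ⊆ G.attractor Φ AE X m) := by
    intro s hs
    have hmem : s ∈ G.attractor Φ AE X (rank s) := Nat.sInf_mem hs
    cases hr : rank s with
    | zero => rw [hr] at hmem; exact hmem.elim
    | succ m =>
      rw [hr] at hmem
      obtain ⟨U, hU, h⟩ := hmem
      exact ⟨U, hU, h.imp_right fun h => ⟨m, by omega, h⟩⟩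
  choose! f hsafe hf using hchoice
  have hsucc : ∀ s, (∃ n, s ∈ G.attractor Φ AE X n) → ∀ s' ∈ G.successors Φ s (f s),
      ∃ n, s' ∈ G.attractor Φ AE X n := by
    intro s hs s' hs'
    rcases hf s hs with ⟨-, -, h⟩ | ⟨m, -, h⟩
    · exact hX s' (h hs')
    · exact ⟨m, h hs'⟩
  have hsome : ∀ {s U}, (if ∃ n, s ∈ G.attractor Φ AE X n then some (f s) else none) = some U ↔
      (∃ n, s ∈ G.attractor Φ AE X n) ∧ f s = U := by
    intro s U
    split_ifs with h <;> simp [h]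
  let σ : Strategy G Φ AE :=
    { toFun := fun s => if ∃ n, s ∈ G.attractor Φ AE X n then some (f s) else none
      dom := fun s U h => (hsafe s (hsome.1 h).1).1
      initial := fun s hs => ⟨f s, hsome.2 ⟨hX s (hinit hs), rfl⟩⟩
      valid := fun s U h => by
        obtain ⟨hs, rfl⟩ := hsome.1 h
        exact (hsafe s hs).2.1
      succ := fun s U h α hα s' ht => by
        obtain ⟨hs, rfl⟩ := hsome.1 h
        exact ⟨f s', hsome.2 ⟨hsucc s hs s' ⟨α, hα, ht⟩, rfl⟩⟩ }
  refine ⟨σ, ?_, ?_⟩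
  · intro s hstep i
    by_contra! hstops
    have hdec : ∀ j ≥ i, rank (s (j + 1)) < rank (s j) := by
      intro j hj
      obtain ⟨U, hU, α, hα, ht⟩ := hstep j
      obtain ⟨hs, rfl⟩ := hsome.1 hU
      rcases hf _ hs with ⟨hE, hfin, -⟩ | ⟨m, hm, h⟩
      · exact absurd ⟨_, hU, hE, hfin⟩ (hstops j hj)
      · exact (hrank (h ⟨α, hα, ht⟩)).trans_lt hm
    have hle : ∀ j, rank (s (i + j)) + j ≤ rank (s i) := by
      intro j
      induction j with
      | zero => simp
      | succ j ih =>
        have := hdec (i + j) (by omega)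
        rw [← add_assoc i j 1]
        omega
    have := hle (rank (s i) + 1)
    omega
  · rintro n s ⟨-, -, U, hU, hE, hfin⟩
    obtain ⟨hs, rfl⟩ := hsome.1 hU
    exact (hsafe _ hs).2.2 hE hfin

end GologProgram

/-! ### From policies to strategies -/

namespace Policy

variable {G : GologProgram S} {Φ : LTLf S} {AE : Set (GAct S)} {π : Policy G AE} {w : World S}

/-- The configuration `c` can be reached in `w` when following the policy. -/
def Reaches (π : Policy G AE) (w : World S) (c : Trace S × Prog S) : Prop :=
  Relation.ReflTransGen (π.Step w) ([], G.prog) c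

lemma Reaches.isConfig {c : Trace S × Prog S} (h : π.Reaches w c) : G.IsConfig c := by
  induction (show Relation.ReflTransGen _ _ c from h) with
  | refl => exact GologProgram.isConfig_initial
  | tail h' hs ih =>
    obtain ⟨U, -, α, -, -, ht⟩ := hs
    exact (ih h').of_trans ht

lemma Reaches.exists_eq_some (hw : G.bat.Sat w) {c : Trace S × Prog S} (h : π.Reaches w c) :
    ∃ U, π.toFun w c.1 c.2 = some U := by
  cases (show Relation.ReflTransGen _ _ c from h) with
  | refl => exact π.initial w hw
  | tail _ hs =>
    obtain ⟨U, hU, α, hα, hz, ht⟩ := hs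
    rw [hz]
    exact π.succ w _ _ U hU α hα _ (by rw [← hz]; exact ht)

/-- A configuration is reached by a run through the prefixes of its trace. -/
lemma Reaches.exists_run {c : Trace S × Prog S} (h : π.Reaches w c) :
    ∃ ρ : ℕ → Prog S, ρ 0 = G.prog ∧ ρ c.1.length = c.2 ∧
      ∀ i < c.1.length, π.Step w (c.1.take i, ρ i) (c.1.take (i + 1), ρ (i + 1)) := by
  induction (show Relation.ReflTransGen _ _ c from h) with
  | refl => exact ⟨fun _ => G.prog, rfl, rfl, by simp⟩
  | @tail c c' h' hs ih =>
    obtain ⟨ρ, h0, hlast, hrun⟩ := ih h'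
    obtain ⟨U, hU, α, hα, hz, ht⟩ := id hs
    have hlen : c'.1.length = c.1.length + 1 := by simp [hz]
    have htake : ∀ i ≤ c.1.length, c'.1.take i = c.1.take i := by
      intro i hi
      rw [hz, List.take_append_of_le_length hi]
    refine ⟨fun i => if i ≤ c.1.length then ρ i else c'.2, by simp [h0], by simp [hlen], ?_⟩
    intro i hi
    dsimp only
    rw [htake i (by omega), if_pos (by omega)]
    by_cases hi' : i < c.1.length
    · rw [htake (i + 1) hi', if_pos (by omega)]
      exact hrun i hi'
    · obtain rfl : i = c.1.length := by omega
      rw [if_neg (by omega), hlast, List.take_length, ← hlen, List.take_length]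
      exact hs

lemma Reaches.mem_traces {c : Trace S × Prog S} (h : π.Reaches w c) (hstops : π.StopsAt w c) :
    c.1 ∈ π.traces w := by
  obtain ⟨ρ, h0, hlast, hrun⟩ := h.exists_run
  exact ⟨ρ, h0, hrun, by rw [hlast]; exact hstops⟩

/-- A terminating policy stops on every infinite run that starts in a reachable configuration. -/
lemma Terminating.exists_stopsAt (hπ : π.Terminating) {c : ℕ → Trace S × Prog S}
    (h0 : π.Reaches w (c 0)) (hstep : ∀ k, π.Step w (c k) (c (k + 1))) :
    ∃ j, π.StopsAt w (c j) := by
  obtain ⟨ρ, hρ0, hlast, hrun⟩ := h0.exists_run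
  set n := (c 0).1.length with hn
  have hjoin : ((c 0).1.take n, ρ n) = c 0 := by rw [hn, List.take_length, hlast]
  let run : ℕ → Trace S × Prog S := fun k =>
    if k < n then ((c 0).1.take k, ρ k) else c (k - n)
  have hrun0 : run 0 = ([], G.prog) := by
    by_cases h : 0 < n
    · simp [run, h, hρ0]
    · obtain h : n = 0 := by omega
      simp only [run, h, lt_irrefl, if_false, Nat.sub_zero]
      rw [← hjoin, h, hρ0, List.take_zero]
  have hrunstep : ∀ k, π.Step w (run k) (run (k + 1)) := by
    intro k
    dsimp only [run]
    rcases lt_trichotomy (k + 1) n with h | h | h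
    · rw [if_pos (by omega), if_pos h]
      exact hrun k (by omega)
    · rw [if_pos (by omega), if_neg (by omega), show k + 1 - n = 0 by omega]
      have := hrun k (by omega)
      rwa [h, hjoin] at this
    · rw [if_neg (by omega), if_neg (by omega), show k + 1 - n = (k - n) + 1 by omega]
      exact hstep _
  obtain ⟨j, hj, hs⟩ := hπ w run hrun0 hrunstep n
  dsimp only [run] at hs
  rw [if_neg (by omega)] at hs
  exact ⟨_, hs⟩

variable (Φ) in
/-- The arena states of the configurations that the policy reaches in worlds of the theory. -/
def reachedStates (π : Policy G AE) : Set (ArenaState S) :=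
  {s | ∃ w c, G.bat.Sat w ∧ π.Reaches w c ∧ s = G.stateOf Φ w c}

/-- In each reached state, the action set chosen by the policy is safe and leads to the states of
the policy's successor configurations. -/
lemma Reaches.isSafe (hac : G.bat.Acyclic) (hπ : π.Satisfies Φ) (hw : G.bat.Sat w)
    {c : Trace S × Prog S} (h : π.Reaches w c) {U : Set (GAct S)}
    (hU : π.toFun w c.1 c.2 = some U) :
    G.IsSafe Φ AE (G.stateOf Φ w c) U ∧
      ∀ s ∈ G.successors Φ (G.stateOf Φ w c) U, ∃ c', π.Step w c c' ∧ s = G.stateOf Φ w c' := by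
  have hc := h.isConfig
  have hiff := fun α => GologProgram.exists_arenaTrans_stateOf_iff (Φ := Φ) hac hw hc (α := α)
  have hfinal := GologProgram.isFinal_stateOf_iff (Φ := Φ) hac hw hc
  refine ⟨⟨GologProgram.stateOf_mem_arenaStates hac hw hc, ⟨(π.dom w _ _ U hU).2, ?_, ?_, ?_⟩, ?_⟩,
    ?_⟩
  · exact fun α hα => (hiff α).2 (π.applicable w _ _ U hU α hα)
  · exact fun α hα s hs => π.environment w _ _ U hU α hα ((hiff α).1 ⟨s, hs⟩)
  · rintro rfl
    exact hfinal.2 (π.nonblocking w _ _ hU)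
  · intro hE hf
    exact (GologProgram.isAccepting_stateOf_iff hac hw hc).2
      (hπ w hw _ (h.mem_traces ⟨U, hU, hE, hfinal.1 hf⟩))
  · rintro s ⟨α, hα, hs⟩
    obtain ⟨ρ', rfl, ht⟩ := (GologProgram.arenaTrans_stateOf_iff hac hw hc).1 hs
    exact ⟨(c.1 ++ [α], ρ'), ⟨U, hU, α, hα, rfl, ht⟩, rfl⟩

/-- Otherwise the policy could be followed forever through reached states outside all attractor
levels, without ever being able to stop. -/
lemma exists_mem_attractor (hac : G.bat.Acyclic) (hterm : π.Terminating) (hπ : π.Satisfies Φ)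
    {s : ArenaState S} (hs : s ∈ π.reachedStates Φ) :
    ∃ n, s ∈ G.attractor Φ AE (π.reachedStates Φ) n := by
  obtain ⟨w, c, hw, hc, rfl⟩ := hs
  by_contra hbad
  let Bad : Trace S × Prog S → Prop := fun c =>
    π.Reaches w c ∧ ¬ ∃ n, G.stateOf Φ w c ∈ G.attractor Φ AE (π.reachedStates Φ) n
  have hstep : ∀ c : {c // Bad c}, ∃ c' : {c // Bad c}, π.Step w c c' ∧ ¬ π.StopsAt w c := by
    rintro ⟨c, hc, hbad⟩
    obtain ⟨U, hU⟩ := hc.exists_eq_some hw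
    obtain ⟨hsafe, hsucc⟩ := hc.isSafe hac hπ hw hU
    have hnotstops : ¬ π.StopsAt w c := by
      rintro ⟨U', hU', hE, hf⟩
      obtain rfl : U = U' := Option.some.inj (hU.symm.trans hU')
      refine hbad ⟨1, U, hsafe,
        Or.inl ⟨hE, (GologProgram.isFinal_stateOf_iff hac hw hc.isConfig).2 hf, fun s hs => ?_⟩⟩
      obtain ⟨c', hcc', rfl⟩ := hsucc s hs
      exact ⟨w, c', hw, hc.tail hcc', rfl⟩
    by_contra! hno
    refine hbad ?_
    obtain ⟨n, hn⟩ := GologProgram.exists_successors_subset_attractor (AE := AE)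
      (X := π.reachedStates Φ) (s := G.stateOf Φ w c) (U := U) (Φ := Φ) (G := G) (by
        intro s hs
        obtain ⟨c', hcc', rfl⟩ := hsucc s hs
        by_contra hb
        exact hnotstops (hno ⟨c', hc.tail hcc', hb⟩ hcc'))
    exact ⟨n + 1, U, hsafe, Or.inr hn⟩
  choose next hnext hnotstops using hstep
  let run : ℕ → {c // Bad c} := fun k => next^[k] ⟨c, hc, hbad⟩
  obtain ⟨j, hj⟩ := hterm.exists_stopsAt (w := w) (c := fun k => (run k).1) hc (fun k => by
    simp only [run, Function.iterate_succ_apply']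
    exact hnext _)
  exact hnotstops (run j) hj

end Policy

end Golog

theorem mainTheorem2 (S : Golog.Signature) (G : Golog.GologProgram S)
    (hacyclic : G.bat.Acyclic) (hdet : G.SituationDetermined)
    (Φ : Golog.LTLf S) (hΦ : Φ.IsC2)
    (AC AE : Set (Golog.GAct S)) (hdisjoint : Disjoint AC AE) (hunion : AC ∪ AE = G.actions) :
    (G.arenaStates Φ).Finite ∧
    ((∃ σ : Golog.Strategy G Φ AE, σ.Terminating ∧ σ.Winning) ↔
      (∃ π : Golog.Policy G AE, π.Terminating ∧ π.Satisfies Φ)) := by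
  refine ⟨G.arenaStates_finite Φ, ?_, ?_⟩
  · rintro ⟨σ, hterm, hwin⟩
    exact ⟨σ.toPolicy hacyclic, σ.toPolicy_terminating hacyclic hterm,
      σ.toPolicy_satisfies hacyclic hwin⟩
  · rintro ⟨π, hterm, hsat⟩
    refine Golog.GologProgram.exists_strategy_of_subset_attractor
      (fun s hs => π.exists_mem_attractor hacyclic hterm hsat hs) fun s hs => ?_
    obtain ⟨w, hw, rfl⟩ := Golog.GologProgram.exists_eq_stateOf_of_mem_arenaInitial hs
    exact ⟨w, _, hw, Relation.ReflTransGen.refl, rfl⟩
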